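/- Let $\mathcal X$ be a finite alphabet, $d:\mathcal X\times\mathcal X\to[0,\infty)$ a per-letter distortion with $d(i,i)=0$, $P_X,P_Y$ two pmf's on $\mathcal X$, $c>0$ and $L_{\max}\ge 0$. Let $\mathcal P$ be the set of pmf's on $\mathcal X$; all logarithms are binary, $\mathcal D(P\|Q)=\sum_a P(a)\log\frac{P(a)}{Q(a)}\in[0,\infty]$, and $\mathrm{EMD}(P,Q)=\min_S\sum_{i,j}S(i,j)d(i,j)$ over the joint pmf's $S$ with marginals $P$ and $Q$. Put $\Gamma(R,L)=\{P\in\mathcal P:\mathrm{EMD}(P,R)\le L\}$ and $h_c(P,Q)=\mathcal D(P\|U)+c\,\mathcal D(Q\|U)$ with $U=\frac{1}{1+c}P+\frac{c}{1+c}Q$. Source identification game with training data (equal training sequences). Let $N=cn$ (rounded down if not an integer), and let $t^N$ be a training sequence drawn from $P_X$ that both players see. For $\lambda>0$, a strategy of the defender is a set $\Lambda$ of pairs of types with denominators $n$ and $N$ such that, for every pmf $P$, if $x^n$ and $t^N$ are drawn from $P$, then $\Pr[(P_{x^n},P_{t^N})\notin\Lambda]\le 2^{-\lambda n}$. A strategy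 of the attacker chooses for each $(y^n,t^N)$ an admissible map, that is, a joint type $S$ with denominator $n$, input marginal $P_{y^n}$ and $\sum_{i,j} S(i,j)d(i,j)\le L_{\max}$; let $S_Z$ be its output marginal. The false negative probability $P_{fn}$ is the probability that $(S_Z(y^n,t^N),P_{t^N})\in\Lambda$, for $y^n$ drawn from $P_Y$ and $t^N$ from $P_X$. At the equilibrium, the defender plays $\{(P,Q):h_{N/n}(P,Q)<\lambda-|\mathcal X|\frac{\log((n+1)(N+1))}{n}\}$ and the attacker plays, for each $(y^n,t^N)$, an admissible map that minimizes $h_{N/n}(S_Z,P_{t^N})$. Let $\varepsilon_{tr}(\lambda)=\lim_{n\to\infty}-\frac1n\log P_{fn}\in[0,\infty]$ at the equilibrium. The game with known sources is the same without training sequences: the defender chooses a set $\Lambda$ of types with denominator $n$ whose false positive probability under $P_X$ is at most $2^{-\lambda n}$. In either game the sources are reliably distinguishable under distortion $L$ if, for some $\lambda>0$ and with $L_{\max}=L$, the defender has strategies for which $\liminf_{n\to\infty} -\frac1n\log P_{fn}$ is bounded below by one positive constant for all attacks. The security margin is the supremum of the $L\ge0$ under which they are reliably distinguishable ($0$ if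 there is none). Theorem. For every $\lambda>0$ the limit $\varepsilon_{tr}(\lambda)$ exists, and $$\lim_{\lambda\to0^+}\varepsilon_{tr}(\lambda)=\min_{R\in\mathcal P}\Big[c\,\mathcal D(R\|P_X)+\min_{P\in\Gamma(R,L_{\max})}\mathcal D(P\|P_Y)\Big],$$ where both minima are attained and the value may be $+\infty$. The same limit is obtained from the single-letter expression $\min_R[c\,\mathcal D(R\|P_X)+\min_{P\in\Gamma_{tr}(R,\lambda,L_{\max})}\mathcal D(P\|P_Y)]$, where $\Gamma_{tr}(R,\lambda,L)=\{P\in\mathcal P:\exists R'\in\mathcal P,\ h_c(R',R)\le\lambda,\ \mathrm{EMD}(P,R')\le L\}$ (read as an infimum). The limit is the supremum, over $\lambda>0$ and over the strategies of the defender, of the false negative exponents that are guaranteed against every attack, and it vanishes if and only if $P_Y\in\Gamma(P_X,L_{\max})$. Consequently, in either game the sources are reliably distinguishable under distortion $L\ge0$ if and only if $L<\mathrm{EMD}(P_Y,P_X)$; the security margin with training data equals the security margin with known sources, and both equal $\mathrm{EMD}(P_Y,P_X)$, which is $\mathrm{EMD}(P_X,P_Y)$ when $d$ is symmetric. -/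

import Mathlib

open Filter Topology

noncomputable section

/-! ### Sequences, types and divergence

A pmf on the finite alphabet `α` is a member of `stdSimplex ℝ α`. All logarithms are binary. -/

/-- Probability that the memoryless source with pmf `P` emits the sequence `x`. -/
def seqProb {α : Type*} (P : α → ℝ) {n : ℕ} (x : Fin n → α) : ℝ :=
  ∏ i, P (x i)

open Classical in
/-- The type (empirical pmf) of a sequence. -/
def empType {α : Type*} {n : ℕ} (x : Fin n → α) : α → ℝ :=
  fun a => ((Finset.univ.filter (fun i => x i = a)).card : ℝ) / n

/-- The set of types with denominator `n`. -/
def typesOf (α : Type*) (n : ℕ) : Set (α → ℝ) :=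
  Set.range (fun x : Fin n → α => empType x)

open Classical in
/-- Kullback-Leibler divergence `D(P‖Q)` in bits, with `0 log 0 = 0` and `p log (p/0) = ∞` for
`p > 0`. -/
def klBits {α : Type*} [Fintype α] (P Q : α → ℝ) : EReal :=
  if ∀ a, Q a = 0 → P a = 0 then
    ((∑ a, P a * Real.logb 2 (P a / Q a) : ℝ) : EReal)
  else ⊤

/-- The generalized log-likelihood ratio function
`h_c(P,Q) = D(P‖U) + c D(Q‖U)`, `U = P/(1+c) + c Q/(1+c)`. When `P` and `Q` are the types of
sequences of lengths `n` and `N` and `c = N/n`, the pmf `U` is the type of their concatenation. -/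
def hGLR {α : Type*} [Fintype α] (c : ℝ) (P Q : α → ℝ) : EReal :=
  klBits P (fun a => 1 / (1 + c) * P a + c / (1 + c) * Q a) +
    (c : EReal) * klBits Q (fun a => 1 / (1 + c) * P a + c / (1 + c) * Q a)

/-- The normalized exponent `-(1/n) log p` of a probability `p`, equal to `∞` if `p = 0`. -/
def expRate (n : ℕ) (p : ℝ) : EReal :=
  if p = 0 then ⊤ else ((-(1 / (n : ℝ)) * Real.logb 2 p : ℝ) : EReal)

/-! ### Transportation maps and the Earth Mover Distance -/

/-- Input marginal of a transportation map. -/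
def inMarg {α : Type*} [Fintype α] (S : α → α → ℝ) : α → ℝ := fun i => ∑ j, S i j

/-- Output marginal of a transportation map. -/
def outMarg {α : Type*} [Fintype α] (S : α → α → ℝ) : α → ℝ := fun j => ∑ i, S i j

/-- Average per-letter distortion of a transportation map. -/
def mapCost {α : Type*} [Fintype α] (d : α → α → ℝ) (S : α → α → ℝ) : ℝ :=
  ∑ i, ∑ j, S i j * d i j

/-- `EMD(P,Q)` for the cost `d`: least cost of a transportation map that carries `P` into `Q`. -/
def EMD {α : Type*} [Fintype α] (d : α → α → ℝ) (P Q : α → ℝ) : ℝ :=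
  sInf (mapCost d '' {S | (∀ i j, 0 ≤ S i j) ∧ inMarg S = P ∧ outMarg S = Q})

/-- The admissible maps for a sequence of length `n` and type `P`: `S i j = n(i,j)/n` with natural
numbers `n(i,j)`, input marginal `P`, and average distortion at most `L`. -/
def admissibleMaps {α : Type*} [Fintype α] (d : α → α → ℝ) (L : ℝ) (n : ℕ) (P : α → ℝ) :
    Set (α → α → ℝ) :=
  {S | (∃ k : α → α → ℕ, ∀ i j, S i j = (k i j : ℝ) / n) ∧ inMarg S = P ∧ mapCost d S ≤ L}

/-! ### The source identification game with training data (equal training sequences)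

Test sequences have length `n`; the training sequence, seen by both players, has length `N`. -/

open Classical in
/-- False positive probability of the acceptance region `Λ` (a set of pairs of types): test and
training sequence are both drawn from `P`, and the pair is not accepted. -/
def falsePosTr {α : Type*} [Fintype α] (n N : ℕ) (P : α → ℝ)
    (Λ : Set ((α → ℝ) × (α → ℝ))) : ℝ :=
  ∑ x : Fin n → α, ∑ t : Fin N → α,
    if (empType x, empType t) ∈ Λ then 0 else seqProb P x * seqProb P t

/-- Strategies of the defender: sets of pairs of types whose false positive probability is at most
`2 ^ (-λ n)`, whatever the source. -/
def defenderTr (α : Type*) [Fintype α] (n N : ℕ) (lam : ℝ) : Set (Set ((α → ℝ) × (α → ℝ))) :=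
  {Λ | Λ ⊆ typesOf α n ×ˢ typesOf α N ∧
    ∀ P ∈ stdSimplex ℝ α, falsePosTr n N P Λ ≤ (2 : ℝ) ^ (-(lam * n))}

/-- Strategies of the attacker: an admissible map for each pair of a sequence to be attacked and a
training sequence. -/
def attackerTr {α : Type*} [Fintype α] (d : α → α → ℝ) (L : ℝ) (n N : ℕ) :
    Set ((Fin n → α) → (Fin N → α) → (α → α → ℝ)) :=
  {S | ∀ y t, S y t ∈ admissibleMaps d L n (empType y)}

open Classical in
/-- False negative probability (the payoff of the attacker): `y` is drawn from `PY`, `t` from `PX`,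
and the attacked sequence is accepted. -/
def falseNegTr {α : Type*} [Fintype α] {n N : ℕ} (PX PY : α → ℝ)
    (Λ : Set ((α → ℝ) × (α → ℝ))) (S : (Fin n → α) → (Fin N → α) → (α → α → ℝ)) : ℝ :=
  ∑ y : Fin n → α, ∑ t : Fin N → α,
    if (outMarg (S y t), empType t) ∈ Λ then seqProb PY y * seqProb PX t else 0

/-- The acceptance region of the defender at the equilibrium:
`h(P,Q) < λ - |α| log((n+1)(N+1)) / n`. -/
def eqRegionTr (α : Type*) [Fintype α] (n N : ℕ) (lam : ℝ) : Set ((α → ℝ) × (α → ℝ)) :=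
  {PQ | PQ.1 ∈ typesOf α n ∧ PQ.2 ∈ typesOf α N ∧
    hGLR ((N : ℝ) / n) PQ.1 PQ.2 <
      ((lam - (Fintype.card α : ℝ) * Real.logb 2 (((n : ℝ) + 1) * ((N : ℝ) + 1)) / n : ℝ) :
        EReal)}

/-- The attack at the equilibrium: for each `y` and `t`, an admissible map that minimizes
`h(S_Z, P_t)`. -/
def IsEqAttackTr {α : Type*} [Fintype α] (d : α → α → ℝ) (L : ℝ) (n N : ℕ)
    (S : (Fin n → α) → (Fin N → α) → (α → α → ℝ)) : Prop :=
  S ∈ attackerTr d L n N ∧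
    ∀ y t, ∀ S' ∈ admissibleMaps d L n (empType y),
      hGLR ((N : ℝ) / n) (outMarg (S y t)) (empType t) ≤
        hGLR ((N : ℝ) / n) (outMarg S') (empType t)

/-- `e` is the error exponent `lim -(1/n) log P_fn` of the false negative probability at the
equilibrium, for training sequences of length `N = c n` (rounded down if it is not an integer).
Equilibrium attacks exist, and all of them give the exponent `e`. -/
def IsFalseNegExpTr {α : Type*} [Fintype α] (c : ℝ) (d : α → α → ℝ) (L : ℝ) (PX PY : α → ℝ)
    (lam : ℝ) (e : EReal) : Prop :=
  (∀ n : ℕ, ∃ S, IsEqAttackTr (α := α) d L n ⌊c * n⌋₊ S) ∧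
    ∀ S : (n : ℕ) → (Fin n → α) → (Fin ⌊c * n⌋₊ → α) → (α → α → ℝ),
      (∀ n, IsEqAttackTr d L n ⌊c * n⌋₊ (S n)) →
        Tendsto (fun n : ℕ => expRate n (falseNegTr PX PY (eqRegionTr α n ⌊c * n⌋₊ lam) (S n)))
          atTop (𝓝 e)

/-- The false negative exponents that the defender can secure against every attack while the false
positive probability decays with some rate `λ > 0`. -/
def achievableTr {α : Type*} [Fintype α] (c : ℝ) (d : α → α → ℝ) (L : ℝ) (PX PY : α → ℝ) :
    Set EReal :=
  {e | ∃ lam : ℝ, 0 < lam ∧ ∃ Λ : ℕ → Set ((α → ℝ) × (α → ℝ)),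
    (∀ n : ℕ, Λ n ∈ defenderTr α n ⌊c * n⌋₊ lam) ∧
    ∀ S : (n : ℕ) → (Fin n → α) → (Fin ⌊c * n⌋₊ → α) → (α → α → ℝ),
      (∀ n, S n ∈ attackerTr d L n ⌊c * n⌋₊) →
        e ≤ liminf (fun n : ℕ => expRate n (falseNegTr PX PY (Λ n) (S n))) atTop}

/-- With training data, the sources can be reliably distinguished under distortion `L`: both error
probabilities decay exponentially, whatever the attack. -/
def DistinguishableTr {α : Type*} [Fintype α] (c : ℝ) (d : α → α → ℝ) (L : ℝ) (PX PY : α → ℝ) :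
    Prop :=
  ∃ e ∈ achievableTr c d L PX PY, 0 < e

/-- Security margin with training data: supremum of the distortions under which the sources can be
reliably distinguished (`0` if there are none). -/
def securityMarginTr {α : Type*} [Fintype α] (c : ℝ) (d : α → α → ℝ) (PX PY : α → ℝ) : ℝ :=
  sSup {L : ℝ | 0 ≤ L ∧ DistinguishableTr c d L PX PY}

/-! ### The source identification game with known sources -/

open Classical in
/-- False positive probability of the acceptance region `Λ` (a set of types). -/
def falsePosKs {α : Type*} [Fintype α] (n : ℕ) (PX : α → ℝ) (Λ : Set (α → ℝ)) : ℝ :=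
  ∑ x : Fin n → α, if empType x ∈ Λ then 0 else seqProb PX x

/-- Strategies of the defender who knows `PX`. -/
def defenderKs {α : Type*} [Fintype α] (PX : α → ℝ) (n : ℕ) (lam : ℝ) : Set (Set (α → ℝ)) :=
  {Λ | Λ ⊆ typesOf α n ∧ falsePosKs n PX Λ ≤ (2 : ℝ) ^ (-(lam * n))}

/-- Strategies of the attacker. -/
def attackerKs {α : Type*} [Fintype α] (d : α → α → ℝ) (L : ℝ) (n : ℕ) :
    Set ((Fin n → α) → (α → α → ℝ)) :=
  {S | ∀ y, S y ∈ admissibleMaps d L n (empType y)}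

open Classical in
/-- False negative probability: `y` is drawn from `PY` and the attacked sequence is accepted. -/
def falseNegKs {α : Type*} [Fintype α] {n : ℕ} (PY : α → ℝ) (Λ : Set (α → ℝ))
    (S : (Fin n → α) → (α → α → ℝ)) : ℝ :=
  ∑ y : Fin n → α, if outMarg (S y) ∈ Λ then seqProb PY y else 0

/-- The false negative exponents that the defender can secure against every attack while the false
positive probability decays with some rate `λ > 0`. -/
def achievableKs {α : Type*} [Fintype α] (d : α → α → ℝ) (L : ℝ) (PX PY : α → ℝ) : Set EReal :=
  {e | ∃ lam : ℝ, 0 < lam ∧ ∃ Λ : ℕ → Set (α → ℝ),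
    (∀ n : ℕ, Λ n ∈ defenderKs PX n lam) ∧
    ∀ S : (n : ℕ) → (Fin n → α) → (α → α → ℝ), (∀ n, S n ∈ attackerKs d L n) →
      e ≤ liminf (fun n : ℕ => expRate n (falseNegKs PY (Λ n) (S n))) atTop}

/-- With known sources, the sources can be reliably distinguished under distortion `L`. -/
def DistinguishableKs {α : Type*} [Fintype α] (d : α → α → ℝ) (L : ℝ) (PX PY : α → ℝ) : Prop :=
  ∃ e ∈ achievableKs d L PX PY, 0 < e

/-- Security margin with known sources. -/
def securityMarginKs {α : Type*} [Fintype α] (d : α → α → ℝ) (PX PY : α → ℝ) : ℝ :=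
  sSup {L : ℝ | 0 ≤ L ∧ DistinguishableKs d L PX PY}

/-! ### Asymptotic regions and exponents -/

/-- `Γ(R, L)`: the pmf's `P` with `EMD(P,R) ≤ L`. -/
def gammaZero {α : Type*} [Fintype α] (d : α → α → ℝ) (L : ℝ) (R : α → ℝ) : Set (α → ℝ) :=
  {P | P ∈ stdSimplex ℝ α ∧ EMD d P R ≤ L}

/-- `Γ_tr(Q, λ, L)`: the pmf's `P` with `EMD(P,R) ≤ L` for some pmf `R` with `h_c(R,Q) ≤ λ`. -/
def gammaTr {α : Type*} [Fintype α] (c : ℝ) (d : α → α → ℝ) (L : ℝ) (lam : ℝ) (Q : α → ℝ) :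
    Set (α → ℝ) :=
  {P | P ∈ stdSimplex ℝ α ∧
    ∃ R ∈ stdSimplex ℝ α, hGLR c R Q ≤ (lam : EReal) ∧ EMD d P R ≤ L}

/-- `min` over `P ∈ G` of `D(P‖PY)`. -/
def minKl {α : Type*} [Fintype α] (PY : α → ℝ) (G : Set (α → ℝ)) : EReal :=
  sInf ((fun P => klBits P PY) '' G)

/-- The objective `c D(R‖PX) + min_{P ∈ G} D(P‖PY)`, where `G` may depend on `R`. -/
def objTr {α : Type*} [Fintype α] (c : ℝ) (PX PY : α → ℝ) (G : (α → ℝ) → Set (α → ℝ))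
    (R : α → ℝ) : EReal :=
  (c : EReal) * klBits R PX + minKl PY (G R)

/-- `min_R [c D(R‖PX) + min_{P ∈ G R} D(P‖PY)]`, `R` ranging over the pmf's. -/
def minObjTr {α : Type*} [Fintype α] (c : ℝ) (PX PY : α → ℝ) (G : (α → ℝ) → Set (α → ℝ)) :
    EReal :=
  sInf (objTr c PX PY G '' stdSimplex ℝ α)

end

/-!
The three quantities in play are the exponent `pairExp`, that is `c D(Q‖PX) + D(P‖PY)`, of a pair
of types `(P, Q)` of the source sequence and the training sequence; the distortion bound, which
confines a joint pmf `S` with input marginal `P` to the compact set `boundedMaps`; and the statistic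
`h_c(S_Z, Q)` of the output marginal, which is continuous (`glrReal`) and vanishes exactly for
`S_Z = Q`.

*The exponent for fixed `λ`.* By the method of types, the false negative probability at the
equilibrium is, up to polynomial factors, the largest `2 ^ (-n pairExp)` over the pairs of types
that some admissible map carries into the acceptance region. Its exponent is `eqExp`, the infimum of
`pairExp` over `S` and `Q` with `h_c(S_Z, Q) < λ`. One inequality (`eqExp_le_liminf`) needs that
acceptance at length `n` implies `h_c < λ` for large `n`: replacing `c` by `⌊c n⌋ / n` changes `h`
by `O(1/n)`, while the threshold is below `λ` by a term of order `(log n)/n` (`eventually_glrReal_lt`).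
The other one (`limsup_le_eqExp`) needs that each `S` is a limit of admissible maps. To round
`n S` to integers without raising the cost or enlarging a support, one rounds down and puts the
remainder on the cheapest cell of the support (`exists_rounding`, `exists_tendsto_admissible`).

*The limit `λ → 0`.* `pairExp` is lower semicontinuous, so on the compact set where it is at most
`b`, for `b` below its minimum over `h_c = 0`, the statistic `h_c` has a positive lower bound
(`exists_pos_forall_glrReal_lt`). This gives the limit both for `eqExp` and for the single-letter
expression.

*Optimality.* Every strategy of the defender contains the acceptance region of the equilibrium,
because under the mixture of a rejected pair of types this pair alone has a probability of about
`2 ^ (-n h)` (`eqRegionTr_subset`); conversely this region for `λ` is a strategy for `λ/2` once `n`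
is large. Hence the supremum of the achievable exponents is the limit, which is positive exactly when
`EMD(PY, PX) > L`.

*Known sources.* The region `D(·‖PX) < m/2` separates the sources when `m > 0` is the minimum of
`D(S_Z‖PX) + D(P‖PY)`, the limit above for `c = 1`. If `EMD(PY, PX) ≤ L`, the rounded
optimal transportation maps carry types near `PY` to types near `PX`, which every strategy of the
defender has to accept.
-/

namespace SourceID

variable {α : Type*} [Fintype α]

/-! ### The method of types -/

/-- The number of occurrences of a letter in a sequence. -/
noncomputable def count {n : ℕ} (x : Fin n → α) (a : α) : ℕ := by
  classical exact (Finset.univ.filter (fun i => x i = a)).card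

omit [Fintype α] in
lemma empType_apply {n : ℕ} (x : Fin n → α) (a : α) : empType x a = (count x a : ℝ) / n := by
  simp only [empType, count]

lemma sum_comp_eq_sum_count {n : ℕ} (x : Fin n → α) (f : α → ℝ) :
    ∑ i, f (x i) = ∑ a, (count x a : ℝ) * f a := by
  classical
  rw [← Finset.sum_fiberwise Finset.univ x (fun i => f (x i))]
  refine Finset.sum_congr rfl fun a _ => ?_
  rw [Finset.sum_congr rfl (g := fun _ => f a)
    (fun i hi => by rw [(Finset.mem_filter.1 hi).2]), Finset.sum_const, nsmul_eq_mul, count]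

lemma sum_count {n : ℕ} (x : Fin n → α) : ∑ a, count x a = n := by
  have := sum_comp_eq_sum_count x (fun _ => 1)
  simp only [Finset.sum_const, Finset.card_univ, Fintype.card_fin, nsmul_eq_mul, mul_one] at this
  exact_mod_cast this.symm

lemma prod_comp_eq_prod_count {n : ℕ} (x : Fin n → α) (f : α → ℝ) :
    ∏ i, f (x i) = ∏ a, f a ^ count x a := by
  classical
  rw [← Finset.prod_fiberwise Finset.univ x (fun i => f (x i))]
  refine Finset.prod_congr rfl fun a _ => ?_
  rw [Finset.prod_congr rfl (g := fun _ => f a)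
    (fun i hi => by rw [(Finset.mem_filter.1 hi).2]), Finset.prod_const, count]

omit [Fintype α] in
lemma count_mul_eq {n : ℕ} (hn : n ≠ 0) (x : Fin n → α) (a : α) :
    (count x a : ℝ) = n * empType x a := by
  rw [empType_apply]; field_simp

lemma empType_mem_stdSimplex {n : ℕ} (hn : n ≠ 0) (x : Fin n → α) :
    empType x ∈ stdSimplex ℝ α := by
  refine ⟨fun a => by rw [empType_apply]; positivity, ?_⟩
  simp only [empType_apply]
  rw [← Finset.sum_div, ← Nat.cast_sum, sum_count]
  field_simp

omit [Fintype α] in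
lemma empType_eq_iff {n : ℕ} (hn : n ≠ 0) (x y : Fin n → α) :
    empType x = empType y ↔ count x = count y := by
  constructor
  · intro h
    funext a
    have := congrFun h a
    rw [empType_apply, empType_apply, div_left_inj' (by exact_mod_cast hn)] at this
    exact_mod_cast this
  · intro h
    funext a
    rw [empType_apply, empType_apply, h]

omit [Fintype α] in
lemma empType_pos {n : ℕ} (x : Fin n → α) (i : Fin n) : 0 < empType x (x i) := by
  have hn : 0 < n := i.pos
  rw [empType_apply]
  have : 0 < count x (x i) := by
    rw [count, Finset.card_pos]
    exact ⟨i, by simp⟩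
  positivity

omit [Fintype α] in
lemma seqProb_nonneg {P : α → ℝ} (hP : ∀ a, 0 ≤ P a) {n : ℕ} (x : Fin n → α) :
    0 ≤ seqProb P x := Finset.prod_nonneg fun _ _ => hP _

lemma sum_seqProb {P : α → ℝ} (hP : P ∈ stdSimplex ℝ α) (n : ℕ) :
    ∑ x : Fin n → α, seqProb P x = 1 := by
  classical
  have := Finset.prod_univ_sum (fun _ : Fin n => (Finset.univ : Finset α)) (fun _ a => P a)
  rw [Fintype.piFinset_univ] at this
  simp only [seqProb]
  rw [← this]
  simp [hP.2]

/-- Every vector of letter counts with total `n` is realized by a sequence of length `n`. -/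
lemma exists_count_eq {n : ℕ} (k : α → ℕ) (hk : ∑ a, k a = n) :
    ∃ x : Fin n → α, count x = k := by
  classical
  have e : (Σ a, Fin (k a)) ≃ Fin n := Fintype.equivOfCardEq (by simp [hk])
  refine ⟨fun i => (e.symm i).1, ?_⟩
  funext a
  have : Fintype.card {i : Fin n // (e.symm i).1 = a} = k a := by
    rw [← Fintype.card_fin (k a)]
    refine Fintype.card_congr ?_
    refine (e.symm.subtypeEquiv (q := fun s => s.1 = a) fun i => Iff.rfl).trans ?_
    exact Equiv.sigmaSubtype a
  rw [← this, count, Fintype.card_subtype]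

/-- The number of sequences with given letter counts is a multinomial coefficient: the permutations
of the positions act transitively on these sequences. -/
lemma card_typeClass_mul [DecidableEq α] {n : ℕ} (x : Fin n → α) :
    (Finset.univ.filter (fun y : Fin n → α => count y = count x)).card *
      ∏ a, (count x a).factorial = n.factorial := by
  classical
  -- The permutations that carry `x` to a given rearrangement form a coset of its stabilizer.
  have hst : ∀ τ : Equiv.Perm (Fin n),
      (Finset.univ.filter (fun σ : Equiv.Perm (Fin n) => x ∘ σ = x ∘ τ)).card =
        ∏ a, (count x a).factorial := by
    intro τ
    have h1 := DomMulAct.stabilizer_card x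
    rw [Fintype.card_subtype] at h1
    have h2 : ∏ a, (count x a).factorial = ∏ a, (Fintype.card {i // x i = a}).factorial := by
      refine Finset.prod_congr rfl fun a _ => ?_
      rw [count, Fintype.card_subtype]
      congr!
    rw [h2, ← h1]
    refine Finset.card_bij' (fun σ _ => σ * τ⁻¹) (fun σ _ => σ * τ) ?_ ?_ ?_ ?_
    · intro σ hσ
      simp only [Finset.mem_filter, Finset.mem_univ, true_and] at hσ ⊢
      rw [Equiv.Perm.coe_mul, ← Function.comp_assoc, hσ, Function.comp_assoc]
      ext i; simp
    · intro σ hσ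
      simp only [Finset.mem_filter, Finset.mem_univ, true_and] at hσ ⊢
      rw [Equiv.Perm.coe_mul, ← Function.comp_assoc, hσ]
    · intro σ _; simp
    · intro σ _; simp
  have hmaps : ∀ σ ∈ (Finset.univ : Finset (Equiv.Perm (Fin n))),
      x ∘ σ ∈ Finset.univ.filter (fun y : Fin n → α => count y = count x) := by
    intro σ _
    simp only [Finset.mem_filter, Finset.mem_univ, true_and]
    funext a
    rw [count, count]
    exact Finset.card_bij (fun i _ => σ i) (by simp) (by simp)
      (fun j hj => ⟨σ⁻¹ j, by simpa using hj, by simp⟩)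
  have := Finset.card_eq_sum_card_fiberwise hmaps
  rw [Finset.card_univ, Fintype.card_perm, Fintype.card_fin] at this
  rw [this, ← smul_eq_mul, ← Finset.sum_const]
  refine Finset.sum_congr rfl fun y hy => ?_
  simp only [Finset.mem_filter, Finset.mem_univ, true_and] at hy
  have he : ∀ a, Nonempty ({i // y i = a} ≃ {i // x i = a}) := by
    intro a
    refine ⟨Fintype.equivOfCardEq ?_⟩
    have := congrFun hy a
    rw [count, count] at this
    rw [Fintype.card_subtype, Fintype.card_subtype]
    convert this
  let τ : Equiv.Perm (Fin n) := Equiv.ofFiberEquiv (fun a => (he a).some)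
  have hτ : x ∘ τ = y := by
    funext i
    exact Equiv.ofFiberEquiv_map _ i
  rw [← hτ]
  exact (hst τ).symm

lemma factorial_mul_pow_le (k m : ℕ) : k.factorial * k ^ m ≤ m.factorial * k ^ k := by
  rcases le_total k m with h | h
  · have := Nat.factorial_mul_pow_sub_le_factorial h
    calc k.factorial * k ^ m = (k.factorial * k ^ (m - k)) * k ^ k := by
          rw [mul_assoc, ← pow_add, Nat.sub_add_cancel h]
      _ ≤ _ := Nat.mul_le_mul_right _ this
  · have : k.factorial ≤ m.factorial * k ^ (k - m) := by
      induction k, h using Nat.le_induction with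
      | base => simp
      | succ k hk ih =>
        rw [Nat.factorial_succ, Nat.succ_sub hk, pow_succ]
        calc (k + 1) * k.factorial ≤ (k + 1) * (m.factorial * k ^ (k - m)) :=
              Nat.mul_le_mul_left _ ih
          _ ≤ (k + 1) * (m.factorial * (k + 1) ^ (k - m)) := by gcongr; omega
          _ = _ := by ring
    calc k.factorial * k ^ m ≤ (m.factorial * k ^ (k - m)) * k ^ m := Nat.mul_le_mul_right _ this
      _ = _ := by rw [mul_assoc, ← pow_add, Nat.sub_add_cancel h]

/-- Under the pmf of a type, no type class is more probable than the class of that type. -/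
lemma card_typeClass_mul_prod_le [DecidableEq α] {n : ℕ} (x z : Fin n → α) :
    (Finset.univ.filter (fun y : Fin n → α => count y = count z)).card *
        ∏ a, count x a ^ count z a ≤
      (Finset.univ.filter (fun y : Fin n → α => count y = count x)).card *
        ∏ a, count x a ^ count x a := by
  have hx := card_typeClass_mul x
  have hz := card_typeClass_mul z
  set A := (Finset.univ.filter (fun y : Fin n → α => count y = count x)).card
  set B := (Finset.univ.filter (fun y : Fin n → α => count y = count z)).card
  have hpos : 0 < (∏ a, (count x a).factorial) * ∏ a, (count z a).factorial :=
    Nat.mul_pos (Finset.prod_pos fun a _ => Nat.factorial_pos _)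
      (Finset.prod_pos fun a _ => Nat.factorial_pos _)
  refine Nat.le_of_mul_le_mul_right ?_ hpos
  have key : (∏ a, (count x a).factorial) * ∏ a, count x a ^ count z a ≤
      (∏ a, (count z a).factorial) * ∏ a, count x a ^ count x a := by
    rw [← Finset.prod_mul_distrib, ← Finset.prod_mul_distrib]
    exact Finset.prod_le_prod' fun a _ => factorial_mul_pow_le _ _
  calc B * (∏ a, count x a ^ count z a) *
        ((∏ a, (count x a).factorial) * ∏ a, (count z a).factorial)
      = (B * ∏ a, (count z a).factorial) *
        ((∏ a, (count x a).factorial) * ∏ a, count x a ^ count z a) := by ring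
    _ ≤ (B * ∏ a, (count z a).factorial) *
        ((∏ a, (count z a).factorial) * ∏ a, count x a ^ count x a) :=
        Nat.mul_le_mul_left _ key
    _ = (A * ∏ a, (count x a).factorial) *
        ((∏ a, (count z a).factorial) * ∏ a, count x a ^ count x a) := by rw [hx, hz]
    _ = _ := by ring

/-- The number of types with denominator `n` is at most `(n+1) ^ |α|`. -/
lemma card_image_count_le [DecidableEq α] (n : ℕ) :
    (Finset.univ.image (fun x : Fin n → α => count x)).card ≤ (n + 1) ^ Fintype.card α := by
  classical
  calc _ ≤ (Fintype.piFinset (fun _ : α => Finset.range (n + 1))).card := by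
        refine Finset.card_le_card fun k hk => ?_
        obtain ⟨x, -, rfl⟩ := Finset.mem_image.1 hk
        rw [Fintype.mem_piFinset]
        intro a
        rw [Finset.mem_range, Nat.lt_succ_iff]
        calc count x a ≤ ∑ b, count x b :=
              Finset.single_le_sum (f := count x) (fun _ _ => Nat.zero_le _) (Finset.mem_univ a)
          _ = n := sum_count x
    _ = _ := by simp [Finset.card_univ]

lemma sum_eq_sum_types [DecidableEq α] {n : ℕ} (f : (Fin n → α) → ℝ) :
    ∑ x, f x = ∑ k ∈ Finset.univ.image (fun x : Fin n → α => count x),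
      ∑ x : Fin n → α with count x = k, f x := by
  rw [Finset.sum_fiberwise_of_maps_to]
  intro x _
  exact Finset.mem_image_of_mem _ (Finset.mem_univ x)

/-- The probabilities of all sequences, each under the pmf of its own type, add up to at most the
number of types. -/
lemma sum_seqProb_empType_le {n : ℕ} (hn : n ≠ 0) :
    ∑ x : Fin n → α, seqProb (empType x) x ≤ ((n : ℝ) + 1) ^ Fintype.card α := by
  classical
  rw [sum_eq_sum_types]
  calc _ ≤ ∑ k ∈ Finset.univ.image (fun x : Fin n → α => count x), (1 : ℝ) := by
        refine Finset.sum_le_sum fun k hk => ?_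
        obtain ⟨z, -, rfl⟩ := Finset.mem_image.1 hk
        have hz := empType_mem_stdSimplex hn z
        calc _ = ∑ x : Fin n → α with count x = count z, seqProb (empType z) x := by
              refine Finset.sum_congr rfl fun x hx => ?_
              rw [(empType_eq_iff hn x z).2 (Finset.mem_filter.1 hx).2]
          _ ≤ ∑ x, seqProb (empType z) x :=
              Finset.sum_le_sum_of_subset_of_nonneg (Finset.filter_subset _ _)
                fun x _ _ => seqProb_nonneg hz.1 x
          _ = 1 := sum_seqProb hz n
    _ ≤ _ := by
        rw [Finset.sum_const, nsmul_eq_mul, mul_one]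
        exact_mod_cast card_image_count_le n

/-- A type class has probability at least `(n+1) ^ (-|α|)` under the pmf of its type. -/
lemma one_le_mul_sum_typeClass [DecidableEq α] {n : ℕ} (hn : n ≠ 0) (x : Fin n → α) :
    1 ≤ ((n : ℝ) + 1) ^ Fintype.card α *
      ∑ y : Fin n → α with count y = count x, seqProb (empType x) y := by
  have hx := empType_mem_stdSimplex hn x
  have hval : ∀ z : Fin n → α, ∑ y : Fin n → α with count y = count z, seqProb (empType x) y =
      ((Finset.univ.filter (fun y : Fin n → α => count y = count z)).card : ℝ) *
        (∏ a, (count x a : ℝ) ^ count z a) / (n : ℝ) ^ n := by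
    intro z
    rw [mul_div_assoc, ← nsmul_eq_mul, ← Finset.sum_const]
    refine Finset.sum_congr rfl fun y hy => ?_
    rw [seqProb, prod_comp_eq_prod_count, (Finset.mem_filter.1 hy).2]
    simp only [empType_apply, div_pow]
    rw [Finset.prod_div_distrib, Finset.prod_pow_eq_pow_sum, sum_count]
  calc (1 : ℝ) = ∑ y : Fin n → α, seqProb (empType x) y := (sum_seqProb hx n).symm
    _ = ∑ k ∈ Finset.univ.image (fun x : Fin n → α => count x),
          ∑ y : Fin n → α with count y = k, seqProb (empType x) y := sum_eq_sum_types _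
    _ ≤ ∑ k ∈ Finset.univ.image (fun x : Fin n → α => count x),
          ∑ y : Fin n → α with count y = count x, seqProb (empType x) y := by
        refine Finset.sum_le_sum fun k hk => ?_
        obtain ⟨z, -, rfl⟩ := Finset.mem_image.1 hk
        rw [hval, hval]
        gcongr ?_ / _
        exact_mod_cast card_typeClass_mul_prod_le x z
    _ ≤ _ := by
        rw [Finset.sum_const, nsmul_eq_mul]
        gcongr
        · exact Finset.sum_nonneg fun y _ => seqProb_nonneg hx.1 y
        · exact_mod_cast card_image_count_le n

/-! ### Divergence -/

/-- Absolute continuity of pmf's: the support of `P` is contained in that of `Q`. -/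
def AbsCont {α : Type*} (P Q : α → ℝ) : Prop := ∀ a, Q a = 0 → P a = 0

/-- The real number that expresses `D(P‖Q)` when `P` is absolutely continuous with respect
to `Q`. -/
noncomputable def klReal (P Q : α → ℝ) : ℝ := ∑ a, P a * Real.logb 2 (P a / Q a)

lemma klBits_of_absCont {P Q : α → ℝ} (h : AbsCont P Q) : klBits P Q = (klReal P Q : EReal) :=
  if_pos h

lemma klBits_of_not_absCont {P Q : α → ℝ} (h : ¬ AbsCont P Q) : klBits P Q = ⊤ := if_neg h

lemma absCont_of_klBits_ne_top {P Q : α → ℝ} (h : klBits P Q ≠ ⊤) : AbsCont P Q := by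
  by_contra h'
  exact h (klBits_of_not_absCont h')

/-- Divergence as an average of the nonnegative function `x log x + 1 - x`. -/
lemma klReal_mul_log_two {P Q : α → ℝ} (hP : P ∈ stdSimplex ℝ α) (hQ : Q ∈ stdSimplex ℝ α)
    (h : AbsCont P Q) :
    klReal P Q * Real.log 2 = ∑ a, Q a * InformationTheory.klFun (P a / Q a) := by
  have h2 : Real.log 2 ≠ 0 := (Real.log_pos one_lt_two).ne'
  have : ∀ a, Q a * InformationTheory.klFun (P a / Q a) =
      P a * Real.logb 2 (P a / Q a) * Real.log 2 + (Q a - P a) := by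
    intro a
    by_cases hq : Q a = 0
    · simp [hq, h a hq]
    · rw [InformationTheory.klFun, Real.logb]
      field_simp
      ring
  simp only [this, Finset.sum_add_distrib, Finset.sum_sub_distrib, hP.2, hQ.2, sub_self, add_zero]
  rw [klReal, Finset.sum_mul]

lemma klReal_nonneg {P Q : α → ℝ} (hP : P ∈ stdSimplex ℝ α) (hQ : Q ∈ stdSimplex ℝ α)
    (h : AbsCont P Q) : 0 ≤ klReal P Q := by
  have h2 : 0 < Real.log 2 := Real.log_pos one_lt_two
  refine nonneg_of_mul_nonneg_left ?_ h2
  rw [klReal_mul_log_two hP hQ h]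
  exact Finset.sum_nonneg fun a _ => mul_nonneg (hQ.1 a)
    (InformationTheory.klFun_nonneg (div_nonneg (hP.1 a) (hQ.1 a)))

lemma eq_of_klReal_eq_zero {P Q : α → ℝ} (hP : P ∈ stdSimplex ℝ α) (hQ : Q ∈ stdSimplex ℝ α)
    (h : AbsCont P Q) (h0 : klReal P Q = 0) : P = Q := by
  have := klReal_mul_log_two hP hQ h
  rw [h0, zero_mul, eq_comm, Finset.sum_eq_zero_iff_of_nonneg] at this
  · funext a
    rcases mul_eq_zero.1 (this a (Finset.mem_univ a)) with h1 | h1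
    · rw [h1, h a h1]
    · rw [InformationTheory.klFun_eq_zero_iff (div_nonneg (hP.1 a) (hQ.1 a))] at h1
      exact eq_of_div_eq_one h1
  · exact fun a _ => mul_nonneg (hQ.1 a)
      (InformationTheory.klFun_nonneg (div_nonneg (hP.1 a) (hQ.1 a)))

lemma klReal_self (P : α → ℝ) : klReal P P = 0 := by
  refine Finset.sum_eq_zero fun a _ => ?_
  by_cases h : P a = 0
  · simp [h]
  · simp [div_self h]

lemma klBits_self (P : α → ℝ) : klBits P P = 0 := by
  rw [klBits_of_absCont fun _ h => h, klReal_self, EReal.coe_zero]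

lemma klBits_nonneg {P Q : α → ℝ} (hP : P ∈ stdSimplex ℝ α) (hQ : Q ∈ stdSimplex ℝ α) :
    0 ≤ klBits P Q := by
  by_cases h : AbsCont P Q
  · rw [klBits_of_absCont h]
    exact_mod_cast klReal_nonneg hP hQ h
  · rw [klBits_of_not_absCont h]; exact le_top

lemma eq_of_klBits_eq_zero {P Q : α → ℝ} (hP : P ∈ stdSimplex ℝ α) (hQ : Q ∈ stdSimplex ℝ α)
    (h0 : klBits P Q = 0) : P = Q := by
  have h : AbsCont P Q := absCont_of_klBits_ne_top (by rw [h0]; exact EReal.zero_ne_top)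
  rw [klBits_of_absCont h] at h0
  exact eq_of_klReal_eq_zero hP hQ h (by exact_mod_cast h0)

lemma continuous_klReal (Q : α → ℝ) : Continuous fun P : α → ℝ => klReal P Q := by
  refine continuous_finsetSum _ fun a _ => ?_
  by_cases hq : Q a = 0
  · simp only [hq, div_zero, Real.logb_zero, mul_zero]
    exact continuous_const
  · have : (fun P : α → ℝ => P a * Real.logb 2 (P a / Q a)) =
        fun P => Q a / Real.log 2 * ((P a / Q a) * Real.log (P a / Q a)) := by
      funext P
      rw [Real.logb]
      field_simp
    rw [this]
    exact continuous_const.mul (Real.continuous_mul_log.comp ((continuous_apply a).div_const _))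

omit [Fintype α] in
lemma isClosed_absCont (Q : α → ℝ) : IsClosed {P : α → ℝ | AbsCont P Q} := by
  simp only [AbsCont, Set.ofPred_forall]
  refine isClosed_iInter fun a => isClosed_iInter fun _ => ?_
  exact isClosed_eq (continuous_apply a) continuous_const

/-- For fixed `Q`, divergence from `Q` is bounded on the simplex, where it is finite. -/
lemma exists_klReal_le (Q : α → ℝ) : ∃ K : ℝ, 0 ≤ K ∧ ∀ P ∈ stdSimplex ℝ α, klReal P Q ≤ K := by
  obtain ⟨K, hK⟩ := (isCompact_stdSimplex ℝ α).bddAbove_image (continuous_klReal Q).continuousOn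
  exact ⟨max K 0, le_max_right _ _,
    fun P hP => (hK (Set.mem_image_of_mem _ hP)).trans (le_max_left _ _)⟩

/-- A function that is continuous and real on a closed set, and `⊤` off it, is lower
semicontinuous. -/
lemma lowerSemicontinuous_of_eq_top_off_closed {X : Type*} [TopologicalSpace X] {C : Set X}
    (hC : IsClosed C) {g : X → ℝ} (hg : Continuous g) {f : X → EReal} (h1 : ∀ x ∈ C, f x = g x)
    (h2 : ∀ x ∉ C, f x = ⊤) : LowerSemicontinuous f := by
  intro x b hb
  by_cases hx : x ∈ C
  · rw [h1 x hx] at hb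
    have := (continuous_coe_real_ereal.comp hg).tendsto x |>.eventually_const_lt hb
    filter_upwards [this] with y hy
    by_cases hyC : y ∈ C
    · rw [h1 y hyC]; exact hy
    · rw [h2 y hyC]
      exact lt_of_lt_of_le hy le_top
  · filter_upwards [hC.isOpen_compl.mem_nhds hx] with y hy
    rw [h2 y hy]
    rw [h2 x hx] at hb
    exact hb

/-! ### Probabilities of sequences through divergence -/

omit [Fintype α] in
lemma absCont_empType_of_seqProb_ne_zero {n : ℕ} {P : α → ℝ} {x : Fin n → α}
    (h : seqProb P x ≠ 0) : AbsCont (empType x) P := by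
  classical
  intro a ha
  by_contra hne
  have : count x a ≠ 0 := by
    intro h0
    rw [empType_apply, h0] at hne
    simp at hne
  rw [count, Finset.card_ne_zero] at this
  obtain ⟨i, hi⟩ := this
  refine h (Finset.prod_eq_zero (Finset.mem_univ i) ?_)
  rw [(Finset.mem_filter.1 hi).2, ha]

/-- The probability of a sequence under `P` is its probability under the pmf of its type, times
`2 ^ (-n D)` for the divergence `D` of the type from `P`. -/
lemma seqProb_eq {n : ℕ} (hn : n ≠ 0) {P : α → ℝ} (hP : ∀ a, 0 ≤ P a) {x : Fin n → α}
    (h : AbsCont (empType x) P) :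
    seqProb P x = seqProb (empType x) x * (2 : ℝ) ^ (-(n * klReal (empType x) P)) := by
  have hpos : ∀ i, 0 < P (x i) := by
    intro i
    refine lt_of_le_of_ne (hP _) fun h0 => ?_
    exact (empType_pos x i).ne' (h _ h0.symm)
  have h1 : (n : ℝ) * klReal (empType x) P =
      ∑ i, Real.logb 2 (empType x (x i) / P (x i)) := by
    rw [sum_comp_eq_sum_count x (fun a => Real.logb 2 (empType x a / P a)), klReal,
      Finset.mul_sum]
    refine Finset.sum_congr rfl fun a _ => ?_
    rw [count_mul_eq hn]; ring
  rw [h1, ← Finset.sum_neg_distrib, Real.rpow_sum_of_pos two_pos, seqProb, seqProb,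
    ← Finset.prod_mul_distrib]
  refine Finset.prod_congr rfl fun i _ => ?_
  have := hpos i
  have := empType_pos x i
  rw [Real.rpow_neg two_pos.le, Real.rpow_logb two_pos (by norm_num) (by positivity)]
  field_simp

/-- A type class has probability at least `(n+1) ^ (-|α|) 2 ^ (-n D)` under `P`, where `D` is the
divergence of the type from `P`. -/
lemma rpow_le_mul_sum_typeClass [DecidableEq α] {n : ℕ} (hn : n ≠ 0) {P : α → ℝ}
    (hP : ∀ a, 0 ≤ P a) (x : Fin n → α) (h : AbsCont (empType x) P) :
    (2 : ℝ) ^ (-(n * klReal (empType x) P)) ≤ ((n : ℝ) + 1) ^ Fintype.card α *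
      ∑ y : Fin n → α with count y = count x, seqProb P y := by
  have hval : ∑ y : Fin n → α with count y = count x, seqProb P y =
      (∑ y : Fin n → α with count y = count x, seqProb (empType x) y) *
        (2 : ℝ) ^ (-(n * klReal (empType x) P)) := by
    rw [Finset.sum_mul]
    refine Finset.sum_congr rfl fun y hy => ?_
    have hxy : empType y = empType x := (empType_eq_iff hn y x).2 (Finset.mem_filter.1 hy).2
    rw [seqProb_eq hn hP (hxy ▸ h), hxy]
  rw [hval, ← mul_assoc]
  exact le_mul_of_one_le_left (by positivity) (one_le_mul_sum_typeClass hn x)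

/-! ### The generalized log-likelihood ratio -/

/-- The mixture `P/(1+c) + c Q/(1+c)`. -/
noncomputable def mix (c : ℝ) (P Q : α → ℝ) : α → ℝ :=
  fun a => 1 / (1 + c) * P a + c / (1 + c) * Q a

/-- The real value of `h_c(P,Q)`, as the entropy defect `(1+c) H(U) - H(P) - c H(Q)` of the
mixture `U`; in this form its continuity is evident. -/
noncomputable def glrReal (c : ℝ) (P Q : α → ℝ) : ℝ :=
  ∑ a, ((1 + c) * Real.negMulLog (mix c P Q a) - Real.negMulLog (P a)
    - c * Real.negMulLog (Q a)) / Real.log 2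

omit [Fintype α] in
lemma mix_eq_zero {c : ℝ} (hc : 0 < c) {P Q : α → ℝ} (hP : ∀ a, 0 ≤ P a) (hQ : ∀ a, 0 ≤ Q a)
    {a : α} (h : mix c P Q a = 0) : P a = 0 ∧ Q a = 0 := by
  have h1 : 0 < 1 / (1 + c) := by positivity
  have h2 : 0 < c / (1 + c) := by positivity
  have h3 := mul_nonneg h1.le (hP a)
  have h4 := mul_nonneg h2.le (hQ a)
  rw [mix, add_eq_zero_iff_of_nonneg h3 h4] at h
  exact ⟨(mul_eq_zero.1 h.1).resolve_left h1.ne', (mul_eq_zero.1 h.2).resolve_left h2.ne'⟩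

omit [Fintype α] in
lemma absCont_mix_left {c : ℝ} (hc : 0 < c) {P Q : α → ℝ} (hP : ∀ a, 0 ≤ P a)
    (hQ : ∀ a, 0 ≤ Q a) : AbsCont P (mix c P Q) := fun _ h => (mix_eq_zero hc hP hQ h).1

omit [Fintype α] in
lemma absCont_mix_right {c : ℝ} (hc : 0 < c) {P Q : α → ℝ} (hP : ∀ a, 0 ≤ P a)
    (hQ : ∀ a, 0 ≤ Q a) : AbsCont Q (mix c P Q) := fun _ h => (mix_eq_zero hc hP hQ h).2

lemma mix_mem_stdSimplex {c : ℝ} (hc : 0 < c) {P Q : α → ℝ} (hP : P ∈ stdSimplex ℝ α)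
    (hQ : Q ∈ stdSimplex ℝ α) : mix c P Q ∈ stdSimplex ℝ α := by
  refine ⟨fun a => ?_, ?_⟩
  · have := hP.1 a
    have := hQ.1 a
    rw [mix]; positivity
  · simp only [mix, Finset.sum_add_distrib, ← Finset.mul_sum, hP.2, hQ.2]
    field_simp

omit [Fintype α] in
lemma mix_self {c : ℝ} (hc : 0 < c) (P : α → ℝ) : mix c P P = P := by
  funext a
  rw [mix]; field_simp

lemma klReal_term {p u : ℝ} (h : u = 0 → p = 0) :
    p * Real.logb 2 (p / u) = (p * Real.log p - p * Real.log u) / Real.log 2 := by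
  by_cases hp : p = 0
  · simp [hp]
  · rw [Real.logb, Real.log_div hp fun hu => hp (h hu)]; ring

lemma glrReal_eq {c : ℝ} (hc : 0 < c) {P Q : α → ℝ} (hP : ∀ a, 0 ≤ P a) (hQ : ∀ a, 0 ≤ Q a) :
    glrReal c P Q = klReal P (mix c P Q) + c * klReal Q (mix c P Q) := by
  rw [klReal, klReal, Finset.mul_sum, ← Finset.sum_add_distrib]
  refine Finset.sum_congr rfl fun a _ => ?_
  rw [klReal_term (absCont_mix_left hc hP hQ a), klReal_term (absCont_mix_right hc hP hQ a)]
  have : (1 + c) * Real.negMulLog (mix c P Q a) =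
      -((P a + c * Q a) * Real.log (mix c P Q a)) := by
    have : P a + c * Q a = (1 + c) * mix c P Q a := by rw [mix]; field_simp
    rw [this, Real.negMulLog]; ring
  rw [this, Real.negMulLog, Real.negMulLog]
  ring

lemma hGLR_eq {c : ℝ} (hc : 0 < c) {P Q : α → ℝ} (hP : ∀ a, 0 ≤ P a) (hQ : ∀ a, 0 ≤ Q a) :
    hGLR c P Q = (glrReal c P Q : EReal) := by
  rw [glrReal_eq hc hP hQ, EReal.coe_add, EReal.coe_mul,
    ← klBits_of_absCont (absCont_mix_left hc hP hQ),
    ← klBits_of_absCont (absCont_mix_right hc hP hQ)]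
  rfl

lemma glrReal_nonneg {c : ℝ} (hc : 0 < c) {P Q : α → ℝ} (hP : P ∈ stdSimplex ℝ α)
    (hQ : Q ∈ stdSimplex ℝ α) : 0 ≤ glrReal c P Q := by
  rw [glrReal_eq hc hP.1 hQ.1]
  have hU := mix_mem_stdSimplex hc hP hQ
  have h1 := klReal_nonneg hP hU (absCont_mix_left hc hP.1 hQ.1)
  have h2 := klReal_nonneg hQ hU (absCont_mix_right hc hP.1 hQ.1)
  positivity

lemma glrReal_self {c : ℝ} (hc : 0 < c) {P : α → ℝ} (hP : P ∈ stdSimplex ℝ α) :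
    glrReal c P P = 0 := by
  rw [glrReal_eq hc hP.1 hP.1, mix_self hc, klReal_self]; ring

lemma eq_of_glrReal_eq_zero {c : ℝ} (hc : 0 < c) {P Q : α → ℝ} (hP : P ∈ stdSimplex ℝ α)
    (hQ : Q ∈ stdSimplex ℝ α) (h : glrReal c P Q = 0) : P = Q := by
  rw [glrReal_eq hc hP.1 hQ.1] at h
  have hU := mix_mem_stdSimplex hc hP hQ
  have a1 := absCont_mix_left hc hP.1 hQ.1
  have a2 := absCont_mix_right hc hP.1 hQ.1
  have h1 := klReal_nonneg hP hU a1
  have h2 := klReal_nonneg hQ hU a2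
  rw [add_eq_zero_iff_of_nonneg h1 (by positivity)] at h
  rw [eq_of_klReal_eq_zero hP hU a1 h.1]
  exact (eq_of_klReal_eq_zero hQ hU a2 ((mul_eq_zero.1 h.2).resolve_left hc.ne')).symm

/-- The mixture minimizes `V ↦ D(P‖V) + c D(Q‖V)`. -/
lemma glrReal_le {c : ℝ} (hc : 0 < c) {P Q V : α → ℝ} (hP : P ∈ stdSimplex ℝ α)
    (hQ : Q ∈ stdSimplex ℝ α) (hV : V ∈ stdSimplex ℝ α) (hPV : AbsCont P V) (hQV : AbsCont Q V) :
    glrReal c P Q ≤ klReal P V + c * klReal Q V := by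
  have hU := mix_mem_stdSimplex hc hP hQ
  have hUV : AbsCont (mix c P Q) V := fun a ha => by rw [mix, hPV a ha, hQV a ha]; ring
  have key : klReal P V + c * klReal Q V =
      glrReal c P Q + (1 + c) * klReal (mix c P Q) V := by
    simp only [klReal, glrReal, Finset.mul_sum, ← Finset.sum_add_distrib]
    refine Finset.sum_congr rfl fun a _ => ?_
    rw [klReal_term (hPV a), klReal_term (hQV a), klReal_term (hUV a), Real.negMulLog,
      Real.negMulLog, Real.negMulLog]
    have : P a + c * Q a = (1 + c) * mix c P Q a := by rw [mix]; field_simp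
    linear_combination (-Real.log (V a) / Real.log 2) * this
  have := klReal_nonneg hU hV hUV
  rw [key]
  have : 0 ≤ (1 + c) * klReal (mix c P Q) V := by positivity
  linarith

/-- `h_c` exceeds `h_{c'}` by at most a multiple of `c - c'`; this controls the rounding of the
length of the training sequence. -/
lemma glrReal_le_glrReal_add {c c' : ℝ} (hc' : 0 < c') (hcc : c' ≤ c) {P Q : α → ℝ}
    (hP : P ∈ stdSimplex ℝ α) (hQ : Q ∈ stdSimplex ℝ α) :
    glrReal c P Q ≤ glrReal c' P Q + (c - c') * Real.logb 2 ((1 + c') / c') := by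
  have a1 := absCont_mix_left hc' hP.1 hQ.1
  have a2 := absCont_mix_right hc' hP.1 hQ.1
  have hU := mix_mem_stdSimplex hc' hP hQ
  have h1 := glrReal_le (hc'.trans_le hcc) hP hQ hU a1 a2
  have h2 : klReal Q (mix c' P Q) ≤ Real.logb 2 ((1 + c') / c') := by
    calc klReal Q (mix c' P Q) ≤ ∑ a, Q a * Real.logb 2 ((1 + c') / c') := by
          refine Finset.sum_le_sum fun a _ => ?_
          rcases (hQ.1 a).eq_or_lt with h0 | h0
          · simp [← h0]
          · have hUpos : 0 < mix c' P Q a :=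
              lt_of_le_of_ne (hU.1 a) fun h => h0.ne' (a2 a h.symm)
            refine mul_le_mul_of_nonneg_left ?_ h0.le
            refine Real.logb_le_logb_of_le one_lt_two (by positivity) ?_
            rw [div_le_div_iff₀ hUpos hc']
            have : (1 + c') * mix c' P Q a = P a + c' * Q a := by rw [mix]; field_simp
            rw [this]
            linarith [hP.1 a]
      _ = _ := by rw [← Finset.sum_mul, hQ.2, one_mul]
  rw [glrReal_eq hc' hP.1 hQ.1]
  nlinarith [mul_le_mul_of_nonneg_left h2 (sub_nonneg.2 hcc)]

lemma continuousAt_glrReal {c : ℝ} (hc : 0 < c) (P Q : α → ℝ) :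
    ContinuousAt (fun z : ℝ × (α → ℝ) × (α → ℝ) => glrReal z.1 z.2.1 z.2.2) (c, P, Q) := by
  have h1 : (1 + c) ≠ 0 := by positivity
  unfold glrReal mix
  refine tendsto_finsetSum _ fun a _ => ?_
  have hP : ContinuousAt (fun z : ℝ × (α → ℝ) × (α → ℝ) => z.2.1 a) (c, P, Q) := by fun_prop
  have hQ : ContinuousAt (fun z : ℝ × (α → ℝ) × (α → ℝ) => z.2.2 a) (c, P, Q) := by fun_prop
  have hcc : ContinuousAt (fun z : ℝ × (α → ℝ) × (α → ℝ) => z.1) (c, P, Q) := by fun_prop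
  have hU : ContinuousAt (fun z : ℝ × (α → ℝ) × (α → ℝ) =>
      1 / (1 + z.1) * z.2.1 a + z.1 / (1 + z.1) * z.2.2 a) (c, P, Q) :=
    ((continuousAt_const.div (continuousAt_const.add hcc) h1).mul hP).add
      ((hcc.div (continuousAt_const.add hcc) h1).mul hQ)
  have hn : ∀ {f : ℝ × (α → ℝ) × (α → ℝ) → ℝ}, ContinuousAt f (c, P, Q) →
      ContinuousAt (fun z => Real.negMulLog (f z)) (c, P, Q) :=
    fun hf => Real.continuous_negMulLog.continuousAt.comp hf
  exact ((((continuousAt_const.add hcc).mul (hn hU)).sub (hn hP)).sub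
    (hcc.mul (hn hQ))).div_const _

lemma continuous_glrReal {c : ℝ} (hc : 0 < c) :
    Continuous fun z : (α → ℝ) × (α → ℝ) => glrReal c z.1 z.2 :=
  continuous_iff_continuousAt.2 fun z =>
    (continuousAt_glrReal hc z.1 z.2).comp
      (f := fun z : (α → ℝ) × (α → ℝ) => (c, z.1, z.2)) (by fun_prop)

/-! ### Transportation maps -/

/-- The joint pmf's on `α × α` with average distortion at most `L`. -/
def boundedMaps (d : α → α → ℝ) (L : ℝ) : Set (α → α → ℝ) :=
  {S | (∀ i j, 0 ≤ S i j) ∧ ∑ i, ∑ j, S i j = 1 ∧ mapCost d S ≤ L}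

lemma continuous_inMarg : Continuous (inMarg : (α → α → ℝ) → α → ℝ) := by
  unfold inMarg; fun_prop

lemma continuous_outMarg : Continuous (outMarg : (α → α → ℝ) → α → ℝ) := by
  unfold outMarg; fun_prop

lemma continuous_glrReal_outMarg {c : ℝ} (hc : 0 < c) :
    Continuous fun z : (α → α → ℝ) × (α → ℝ) => glrReal c (outMarg z.1) z.2 := by
  have hmarg : Continuous fun z : (α → α → ℝ) × (α → ℝ) => (outMarg z.1, z.2) :=
    (continuous_outMarg.comp continuous_fst).prodMk continuous_snd
  have h := (continuous_glrReal (α := α) hc).comp hmarg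
  exact h

lemma continuous_mapCost (d : α → α → ℝ) : Continuous (mapCost d) := by
  unfold mapCost; fun_prop

lemma inMarg_mem_stdSimplex {S : α → α → ℝ} (h0 : ∀ i j, 0 ≤ S i j)
    (h1 : ∑ i, ∑ j, S i j = 1) : inMarg S ∈ stdSimplex ℝ α :=
  ⟨fun i => Finset.sum_nonneg fun j _ => h0 i j, h1⟩

lemma outMarg_mem_stdSimplex {S : α → α → ℝ} (h0 : ∀ i j, 0 ≤ S i j)
    (h1 : ∑ i, ∑ j, S i j = 1) : outMarg S ∈ stdSimplex ℝ α :=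
  ⟨fun j => Finset.sum_nonneg fun i _ => h0 i j, by
    rw [← h1, Finset.sum_comm (f := fun i j => S i j)]; rfl⟩

lemma le_one_of_sum_eq_one {S : α → α → ℝ} (h0 : ∀ i j, 0 ≤ S i j)
    (h1 : ∑ i, ∑ j, S i j = 1) (i j : α) : S i j ≤ 1 := by
  rw [← h1]
  exact (Finset.single_le_sum (f := fun j => S i j) (fun j _ => h0 i j) (Finset.mem_univ j)).trans
    (Finset.single_le_sum (f := fun i => ∑ j, S i j)
      (fun i _ => Finset.sum_nonneg fun j _ => h0 i j) (Finset.mem_univ i))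

omit [Fintype α] in
lemma isClosed_nonneg : IsClosed {S : α → α → ℝ | ∀ i j, 0 ≤ S i j} := by
  simp only [Set.ofPred_forall]
  exact isClosed_iInter fun i => isClosed_iInter fun j =>
    isClosed_le continuous_const (by fun_prop)

lemma isCompact_jointPmf :
    IsCompact {S : α → α → ℝ | (∀ i j, 0 ≤ S i j) ∧ ∑ i, ∑ j, S i j = 1} := by
  refine (isCompact_Icc (a := (0 : α → α → ℝ)) (b := 1)).of_isClosed_subset ?_ ?_
  · exact isClosed_nonneg.inter (isClosed_eq (by fun_prop) continuous_const)
  · rintro S ⟨h0, h1⟩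
    exact ⟨fun i j => h0 i j, fun i j => le_one_of_sum_eq_one h0 h1 i j⟩

lemma isCompact_boundedMaps (d : α → α → ℝ) (L : ℝ) : IsCompact (boundedMaps d L) := by
  have : boundedMaps d L = {S : α → α → ℝ | (∀ i j, 0 ≤ S i j) ∧ ∑ i, ∑ j, S i j = 1} ∩
      {S | mapCost d S ≤ L} := by
    ext S; simp [boundedMaps, and_assoc]
  rw [this]
  exact isCompact_jointPmf.inter_right (isClosed_le (continuous_mapCost d) continuous_const)

lemma mapCost_nonneg {d : α → α → ℝ} (hd : ∀ i j, 0 ≤ d i j) {S : α → α → ℝ}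
    (h0 : ∀ i j, 0 ≤ S i j) : 0 ≤ mapCost d S :=
  Finset.sum_nonneg fun i _ => Finset.sum_nonneg fun j _ => mul_nonneg (h0 i j) (hd i j)

lemma EMD_le_mapCost {d : α → α → ℝ} (hd : ∀ i j, 0 ≤ d i j) {S : α → α → ℝ}
    (h0 : ∀ i j, 0 ≤ S i j) : EMD d (inMarg S) (outMarg S) ≤ mapCost d S := by
  refine csInf_le ⟨0, ?_⟩ ⟨S, ⟨h0, rfl, rfl⟩, rfl⟩
  rintro _ ⟨S', ⟨h0', -⟩, rfl⟩
  exact mapCost_nonneg hd h0'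

lemma EMD_nonneg {d : α → α → ℝ} (hd : ∀ i j, 0 ≤ d i j) (P Q : α → ℝ) : 0 ≤ EMD d P Q := by
  refine Real.sInf_nonneg ?_
  rintro _ ⟨S', ⟨h0', -⟩, rfl⟩
  exact mapCost_nonneg hd h0'

/-- The Earth Mover Distance of two pmf's is attained by a joint pmf. -/
lemma exists_mapCost_eq_EMD (d : α → α → ℝ) {P Q : α → ℝ} (hP : P ∈ stdSimplex ℝ α)
    (hQ : Q ∈ stdSimplex ℝ α) :
    ∃ S : α → α → ℝ, (∀ i j, 0 ≤ S i j) ∧ inMarg S = P ∧ outMarg S = Q ∧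
      mapCost d S = EMD d P Q := by
  have hcomp : IsCompact {S : α → α → ℝ | (∀ i j, 0 ≤ S i j) ∧ inMarg S = P ∧ outMarg S = Q} := by
    refine isCompact_jointPmf.of_isClosed_subset ?_ ?_
    · exact isClosed_nonneg.inter ((isClosed_eq continuous_inMarg continuous_const).inter
        (isClosed_eq continuous_outMarg continuous_const))
    · rintro S ⟨h0, h1, -⟩
      refine ⟨h0, ?_⟩
      rw [← hP.2, ← h1]
      rfl
  have hne : {S : α → α → ℝ | (∀ i j, 0 ≤ S i j) ∧ inMarg S = P ∧ outMarg S = Q}.Nonempty := by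
    refine ⟨fun i j => P i * Q j, fun i j => mul_nonneg (hP.1 i) (hQ.1 j), ?_, ?_⟩
    · funext i; simp only [inMarg, ← Finset.mul_sum, hQ.2, mul_one]
    · funext j; simp only [outMarg, ← Finset.sum_mul, hP.2, one_mul]
  obtain ⟨S, hS, h⟩ := hcomp.exists_sInf_image_eq hne (continuous_mapCost d).continuousOn
  exact ⟨S, hS.1, hS.2.1, hS.2.2, h.symm⟩

lemma EMD_le_of_mem {d : α → α → ℝ} (hd : ∀ i j, 0 ≤ d i j) {L : ℝ} {S : α → α → ℝ}
    (hS : S ∈ boundedMaps d L) : EMD d (inMarg S) (outMarg S) ≤ L :=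
  (EMD_le_mapCost hd hS.1).trans hS.2.2

lemma exists_mem_boundedMaps {d : α → α → ℝ} {L : ℝ} {P Q : α → ℝ}
    (hP : P ∈ stdSimplex ℝ α) (hQ : Q ∈ stdSimplex ℝ α) (h : EMD d P Q ≤ L) :
    ∃ S ∈ boundedMaps d L, inMarg S = P ∧ outMarg S = Q := by
  obtain ⟨S, h0, h1, h2, h3⟩ := exists_mapCost_eq_EMD d hP hQ
  refine ⟨S, ⟨h0, ?_, h3.trans_le h⟩, h1, h2⟩
  rw [← hP.2, ← h1]
  rfl

lemma EMD_self {d : α → α → ℝ} (hd : ∀ i j, 0 ≤ d i j) (hself : ∀ i, d i i = 0) {P : α → ℝ}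
    (hP : P ∈ stdSimplex ℝ α) : EMD d P P = 0 := by
  classical
  refine le_antisymm ?_ (EMD_nonneg hd P P)
  have := EMD_le_mapCost hd (S := fun i j => if i = j then P i else 0)
    fun i j => by split_ifs; exacts [hP.1 i, le_rfl]
  have h1 : inMarg (fun i j => if i = j then P i else 0) = P := by
    funext i; simp [inMarg]
  have h2 : outMarg (fun i j => if i = j then P i else 0) = P := by
    funext i; simp [outMarg]
  have h3 : mapCost d (fun i j => if i = j then P i else 0) = 0 := by
    simp [mapCost, hself]
  rwa [h1, h2, h3] at this

lemma EMD_comm {d : α → α → ℝ} (hsymm : ∀ i j, d i j = d j i) (P Q : α → ℝ) :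
    EMD d P Q = EMD d Q P := by
  have key : ∀ P Q : α → ℝ,
      mapCost d '' {S | (∀ i j, 0 ≤ S i j) ∧ inMarg S = P ∧ outMarg S = Q} ⊆
        mapCost d '' {S | (∀ i j, 0 ≤ S i j) ∧ inMarg S = Q ∧ outMarg S = P} := by
    rintro P Q _ ⟨S, ⟨h0, h1, h2⟩, rfl⟩
    refine ⟨fun i j => S j i, ⟨fun i j => h0 j i, h2, h1⟩, ?_⟩
    simp only [mapCost]
    rw [Finset.sum_comm]
    simp only [hsymm]
  rw [EMD, EMD, (key P Q).antisymm (key Q P)]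

/-! ### The exponent of a pair of types and its minimization -/

/-- The exponent `c D(Q‖PX) + D(P‖PY)` of the event that the attacked sequence has the type
`P`, the input marginal of `S`, and the training sequence the type `Q`. -/
noncomputable def pairExp (c : ℝ) (PX PY : α → ℝ) (S : α → α → ℝ) (Q : α → ℝ) : EReal :=
  (c : EReal) * klBits Q PX + klBits (inMarg S) PY

lemma pairExp_of_absCont {c : ℝ} {PX PY : α → ℝ} {S : α → α → ℝ} {Q : α → ℝ}
    (h1 : AbsCont Q PX) (h2 : AbsCont (inMarg S) PY) :
    pairExp c PX PY S Q = ((c * klReal Q PX + klReal (inMarg S) PY : ℝ) : EReal) := by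
  rw [pairExp, klBits_of_absCont h1, klBits_of_absCont h2, EReal.coe_add, EReal.coe_mul]

lemma klBits_ne_bot (P Q : α → ℝ) : klBits P Q ≠ ⊥ := by
  unfold klBits; split_ifs
  · exact EReal.coe_ne_bot _
  · exact top_ne_bot

lemma mul_klBits_ne_bot {c : ℝ} (hc : 0 < c) (P Q : α → ℝ) : (c : EReal) * klBits P Q ≠ ⊥ := by
  unfold klBits; split_ifs
  · rw [← EReal.coe_mul]; exact EReal.coe_ne_bot _
  · rw [EReal.coe_mul_top_of_pos hc]; exact top_ne_bot

lemma pairExp_of_not {c : ℝ} (hc : 0 < c) {PX PY : α → ℝ} {S : α → α → ℝ} {Q : α → ℝ}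
    (h : ¬ (AbsCont Q PX ∧ AbsCont (inMarg S) PY)) : pairExp c PX PY S Q = ⊤ := by
  rw [not_and_or] at h
  rcases h with h | h
  · rw [pairExp, klBits_of_not_absCont h, EReal.coe_mul_top_of_pos hc,
      EReal.top_add_of_ne_bot (klBits_ne_bot _ _)]
  · rw [pairExp, klBits_of_not_absCont h, EReal.add_top_of_ne_bot (mul_klBits_ne_bot hc _ _)]

lemma absCont_of_pairExp_ne_top {c : ℝ} (hc : 0 < c) {PX PY : α → ℝ} {S : α → α → ℝ}
    {Q : α → ℝ} (h : pairExp c PX PY S Q ≠ ⊤) : AbsCont Q PX ∧ AbsCont (inMarg S) PY := by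
  by_contra h'
  exact h (pairExp_of_not hc h')

lemma lowerSemicontinuous_pairExp {c : ℝ} (hc : 0 < c) (PX PY : α → ℝ) :
    LowerSemicontinuous fun z : (α → α → ℝ) × (α → ℝ) => pairExp c PX PY z.1 z.2 := by
  refine lowerSemicontinuous_of_eq_top_off_closed
    (C := {z | AbsCont z.2 PX ∧ AbsCont (inMarg z.1) PY})
    (g := fun z => c * klReal z.2 PX + klReal (inMarg z.1) PY) ?_ ?_ ?_ ?_
  · exact ((isClosed_absCont PX).preimage continuous_snd).inter
      ((isClosed_absCont PY).preimage (continuous_inMarg.comp continuous_fst))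
  · exact (continuous_const.mul ((continuous_klReal PX).comp continuous_snd)).add
      ((continuous_klReal PY).comp (continuous_inMarg.comp continuous_fst))
  · exact fun z hz => pairExp_of_absCont hz.1 hz.2
  · exact fun z hz => pairExp_of_not hc hz

lemma pairExp_nonneg {c : ℝ} (hc : 0 < c) {PX PY : α → ℝ} (hPX : PX ∈ stdSimplex ℝ α)
    (hPY : PY ∈ stdSimplex ℝ α) {S : α → α → ℝ} {Q : α → ℝ}
    (hS : inMarg S ∈ stdSimplex ℝ α) (hQ : Q ∈ stdSimplex ℝ α) : 0 ≤ pairExp c PX PY S Q :=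
  add_nonneg (mul_nonneg (by exact_mod_cast hc.le) (klBits_nonneg hQ hPX)) (klBits_nonneg hS hPY)

section Minimum

variable {d : α → α → ℝ} (hd : ∀ i j, 0 ≤ d i j) (hself : ∀ i, d i i = 0)
  {PX PY : α → ℝ} (hPX : PX ∈ stdSimplex ℝ α) (hPY : PY ∈ stdSimplex ℝ α)
  {c : ℝ} (hc : 0 < c) {L : ℝ} (hL : 0 ≤ L)

include hd hself hL in
lemma self_mem_gammaZero {R : α → ℝ} (hR : R ∈ stdSimplex ℝ α) : R ∈ gammaZero d L R :=
  ⟨hR, by rwa [EMD_self hd hself hR]⟩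

include hd in
lemma gammaZero_eq_image {R : α → ℝ} (hR : R ∈ stdSimplex ℝ α) :
    gammaZero d L R = inMarg '' {S ∈ boundedMaps d L | outMarg S = R} := by
  ext P
  constructor
  · rintro ⟨hP, h⟩
    obtain ⟨S, hS, h1, h2⟩ := exists_mem_boundedMaps hP hR h
    exact ⟨S, ⟨hS, h2⟩, h1⟩
  · rintro ⟨S, ⟨hS, rfl⟩, rfl⟩
    exact ⟨inMarg_mem_stdSimplex hS.1 hS.2.1, EMD_le_of_mem hd hS⟩

include hd hself hL in
lemma isLeast_minKl_gammaZero (PY : α → ℝ) {R : α → ℝ} (hR : R ∈ stdSimplex ℝ α) :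
    IsLeast ((fun P => klBits P PY) '' gammaZero d L R) (minKl PY (gammaZero d L R)) := by
  have hcomp : IsCompact (gammaZero d L R) := by
    rw [gammaZero_eq_image hd hR]
    exact ((isCompact_boundedMaps d L).inter_right
      (isClosed_eq continuous_outMarg continuous_const)).image continuous_inMarg
  have hlsc : LowerSemicontinuous fun P : α → ℝ => klBits P PY :=
    lowerSemicontinuous_of_eq_top_off_closed (isClosed_absCont PY) (continuous_klReal PY)
      (fun _ h => klBits_of_absCont h) (fun _ h => klBits_of_not_absCont h)
  obtain ⟨P, hP, hmin⟩ := LowerSemicontinuousOn.exists_isMinOn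
    ⟨R, self_mem_gammaZero hd hself hL hR⟩ hcomp (hlsc.lowerSemicontinuousOn _)
  have hleast : IsLeast ((fun P => klBits P PY) '' gammaZero d L R) (klBits P PY) :=
    ⟨⟨P, hP, rfl⟩, by rintro _ ⟨P', hP', rfl⟩; exact hmin hP'⟩
  rw [minKl, hleast.isGLB.sInf_eq]
  exact hleast

include hd in
lemma objTr_le_pairExp {S : α → α → ℝ} (hS : S ∈ boundedMaps d L) :
    objTr c PX PY (gammaZero d L) (outMarg S) ≤ pairExp c PX PY S (outMarg S) :=
  add_le_add le_rfl (sInf_le ⟨inMarg S,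
    ⟨inMarg_mem_stdSimplex hS.1 hS.2.1, EMD_le_of_mem hd hS⟩, rfl⟩)

lemma minObjTr_le_objTr {G : (α → ℝ) → Set (α → ℝ)} {R : α → ℝ} (hR : R ∈ stdSimplex ℝ α) :
    minObjTr c PX PY G ≤ objTr c PX PY G R := sInf_le ⟨R, hR, rfl⟩

include hd in
lemma minObjTr_le_pairExp {S : α → α → ℝ} (hS : S ∈ boundedMaps d L) :
    minObjTr c PX PY (gammaZero d L) ≤ pairExp c PX PY S (outMarg S) :=
  (minObjTr_le_objTr (outMarg_mem_stdSimplex hS.1 hS.2.1)).trans (objTr_le_pairExp hd hS)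

include hd hself hL hc hPX in
/-- Both minima in the limit formula are attained together, by a single joint pmf. -/
lemma exists_isLeast_minObjTr :
    (∃ S ∈ boundedMaps d L, pairExp c PX PY S (outMarg S) = minObjTr c PX PY (gammaZero d L)) ∧
    IsLeast (objTr c PX PY (gammaZero d L) '' stdSimplex ℝ α)
      (minObjTr c PX PY (gammaZero d L)) := by
  have hne : (boundedMaps d L).Nonempty := by
    obtain ⟨S, hS, -⟩ := exists_mem_boundedMaps hPX hPX
      (show EMD d PX PX ≤ L by rwa [EMD_self hd hself hPX])
    exact ⟨S, hS⟩
  have hlsc : LowerSemicontinuous fun S : α → α → ℝ => pairExp c PX PY S (outMarg S) :=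
    (lowerSemicontinuous_pairExp hc PX PY).comp
      (continuous_id.prodMk continuous_outMarg)
  obtain ⟨S, hS, hmin⟩ := LowerSemicontinuousOn.exists_isMinOn hne (isCompact_boundedMaps d L)
    (hlsc.lowerSemicontinuousOn _)
  have hR := outMarg_mem_stdSimplex hS.1 hS.2.1
  have hlow : ∀ R ∈ stdSimplex ℝ α,
      pairExp c PX PY S (outMarg S) ≤ objTr c PX PY (gammaZero d L) R := by
    intro R hR
    obtain ⟨P, hP, hPe⟩ := (isLeast_minKl_gammaZero hd hself hL PY hR).1
    obtain ⟨S', hS', h1, h2⟩ := exists_mem_boundedMaps hP.1 hR hP.2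
    have := hmin hS'
    rw [objTr, ← hPe, ← h1, ← h2]
    exact this
  have heq : pairExp c PX PY S (outMarg S) = minObjTr c PX PY (gammaZero d L) := by
    refine le_antisymm ?_ (minObjTr_le_pairExp hd hS)
    refine le_sInf ?_
    rintro _ ⟨R, hR, rfl⟩
    exact hlow R hR
  refine ⟨⟨S, hS, heq⟩, ⟨outMarg S, hR, ?_⟩, ?_⟩
  · refine le_antisymm ?_ (minObjTr_le_objTr hR)
    rw [← heq]
    exact objTr_le_pairExp hd hS
  · rintro _ ⟨R, hR, rfl⟩
    exact sInf_le ⟨R, hR, rfl⟩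

include hd hself hL hc hPX hPY in
lemma minObjTr_nonneg : 0 ≤ minObjTr c PX PY (gammaZero d L) := by
  obtain ⟨⟨S, hS, h⟩, -⟩ := exists_isLeast_minObjTr (PY := PY) hd hself hPX hc hL
  rw [← h]
  exact pairExp_nonneg hc hPX hPY (inMarg_mem_stdSimplex hS.1 hS.2.1)
    (outMarg_mem_stdSimplex hS.1 hS.2.1)

include hd hself hL hc hPX hPY in
lemma minObjTr_eq_zero_iff :
    minObjTr c PX PY (gammaZero d L) = 0 ↔ PY ∈ gammaZero d L PX := by
  constructor
  · intro h0
    obtain ⟨⟨S, hS, h⟩, -⟩ := exists_isLeast_minObjTr (PY := PY) hd hself hPX hc hL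
    have hin := inMarg_mem_stdSimplex hS.1 hS.2.1
    have hout := outMarg_mem_stdSimplex hS.1 hS.2.1
    rw [h0, pairExp] at h
    have h1 : 0 ≤ (c : EReal) * klBits (outMarg S) PX :=
      mul_nonneg (by exact_mod_cast hc.le) (klBits_nonneg hout hPX)
    have h2 := klBits_nonneg hin hPY
    rw [add_eq_zero_iff_of_nonneg h1 h2, mul_eq_zero] at h
    rw [← eq_of_klBits_eq_zero hin hPY h.2, ← eq_of_klBits_eq_zero hout hPX
      (h.1.resolve_left (by exact_mod_cast hc.ne'))]
    exact ⟨hin, EMD_le_of_mem hd hS⟩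
  · intro h
    obtain ⟨S, hS, h1, h2⟩ := exists_mem_boundedMaps h.1 hPX h.2
    refine le_antisymm ?_ (minObjTr_nonneg hd hself hPX hPY hc hL)
    refine (minObjTr_le_pairExp (PX := PX) (PY := PY) (c := c) hd hS).trans ?_
    rw [pairExp, h1, h2, klBits_self, klBits_self, mul_zero, add_zero]

/-! ### The limit of vanishing false positive exponent -/

include hd hc in
/-- Below the minimum at `h_c = 0`, the exponent stays large for small `h_c`, by compactness. -/
lemma exists_pos_forall_glrReal_lt {b : ℝ} (hb : (b : EReal) < minObjTr c PX PY (gammaZero d L)) :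
    ∃ δ > 0, ∀ S ∈ boundedMaps d L, ∀ Q ∈ stdSimplex ℝ α,
      glrReal c (outMarg S) Q < δ → (b : EReal) < pairExp c PX PY S Q := by
  set Z : Set ((α → α → ℝ) × (α → ℝ)) := (boundedMaps d L ×ˢ stdSimplex ℝ α) ∩
    ((fun z : (α → α → ℝ) × (α → ℝ) => pairExp c PX PY z.1 z.2) ⁻¹' Set.Iic (b : EReal)) with hZ
  have hclosed : IsClosed
      ((fun z : (α → α → ℝ) × (α → ℝ) => pairExp c PX PY z.1 z.2) ⁻¹' Set.Iic (b : EReal)) :=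
    (lowerSemicontinuous_pairExp hc PX PY).isClosed_preimage _
  have hprod : IsCompact (boundedMaps d L ×ˢ stdSimplex ℝ α) :=
    (isCompact_boundedMaps d L).prod (isCompact_stdSimplex ℝ α)
  have hcomp : IsCompact Z := hprod.inter_right hclosed
  rcases Z.eq_empty_or_nonempty with hemp | hne
  · refine ⟨1, one_pos, fun S hS Q hQ _ => ?_⟩
    by_contra h
    have : (S, Q) ∈ Z := ⟨⟨hS, hQ⟩, not_lt.1 h⟩
    rw [hemp] at this
    exact this
  · obtain ⟨z, hz, hmin⟩ :=
      hcomp.exists_isMinOn hne (continuous_glrReal_outMarg hc).continuousOn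
    have hout := outMarg_mem_stdSimplex hz.1.1.1 hz.1.1.2.1
    refine ⟨glrReal c (outMarg z.1) z.2, ?_, fun S hS Q hQ hlt => ?_⟩
    · refine lt_of_le_of_ne (glrReal_nonneg hc hout hz.1.2) fun h0 => ?_
      have heq := eq_of_glrReal_eq_zero hc hout hz.1.2 h0.symm
      have := minObjTr_le_pairExp (PX := PX) (PY := PY) (c := c) hd hz.1.1
      rw [heq] at this
      exact absurd (hb.trans_le this) (not_lt.2 hz.2)
    · by_contra h
      have hSQ : (S, Q) ∈ Z := ⟨⟨hS, hQ⟩, not_lt.1 h⟩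
      have hle := isMinOn_iff.1 hmin _ hSQ
      exact absurd hlt (not_lt.2 hle)

/-- The exponent of the false negative probability at the equilibrium. The strict inequality
`h_c < λ` is that of the acceptance region; for some sources and some `λ` the closed condition
gives another value. -/
noncomputable def eqExp (c : ℝ) (d : α → α → ℝ) (L : ℝ) (PX PY : α → ℝ) (lam : ℝ) : EReal :=
  sInf {e | ∃ S ∈ boundedMaps d L, ∃ Q ∈ stdSimplex ℝ α,
    glrReal c (outMarg S) Q < lam ∧ pairExp c PX PY S Q = e}

lemma tendsto_of_le_of_eventually_le {f : ℝ → EReal} {v : EReal} (h1 : ∀ lam > 0, f lam ≤ v)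
    (h2 : ∀ b : ℝ, (b : EReal) < v → ∃ δ > 0, ∀ lam < δ, (b : EReal) ≤ f lam) :
    Tendsto f (𝓝[>] 0) (𝓝 v) := by
  rw [tendsto_order]
  constructor
  · intro a ha
    obtain ⟨b, hab, hbv⟩ := EReal.lt_iff_exists_real_btwn.1 ha
    obtain ⟨δ, hδ, h⟩ := h2 b hbv
    filter_upwards [Ioo_mem_nhdsGT hδ] with lam hlam
    exact hab.trans_le (h lam hlam.2)
  · intro a ha
    filter_upwards [self_mem_nhdsWithin] with lam hlam
    exact (h1 lam hlam).trans_lt ha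

include hd hself hL hc hPX in
lemma eqExp_le {lam : ℝ} (hlam : 0 < lam) :
    eqExp c d L PX PY lam ≤ minObjTr c PX PY (gammaZero d L) := by
  obtain ⟨⟨S, hS, h⟩, -⟩ := exists_isLeast_minObjTr (PY := PY) hd hself hPX hc hL
  have hout := outMarg_mem_stdSimplex hS.1 hS.2.1
  exact sInf_le ⟨S, hS, outMarg S, hout, by rwa [glrReal_self hc hout], h⟩

include hd hself hL hc hPX in
lemma tendsto_eqExp :
    Tendsto (eqExp c d L PX PY) (𝓝[>] 0) (𝓝 (minObjTr c PX PY (gammaZero d L))) := by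
  refine tendsto_of_le_of_eventually_le (fun lam hlam => eqExp_le hd hself hPX hc hL hlam) ?_
  intro b hb
  obtain ⟨δ, hδ, h⟩ := exists_pos_forall_glrReal_lt hd hc hb
  refine ⟨δ, hδ, fun lam hlam => le_sInf ?_⟩
  rintro _ ⟨S, hS, Q, hQ, hlt, rfl⟩
  exact (h S hS Q hQ (hlt.trans hlam)).le

lemma le_add_minKl {a : EReal} (ha : a ≠ ⊥) (hPY : PY ∈ stdSimplex ℝ α) {G : Set (α → ℝ)}
    (hG : G ⊆ stdSimplex ℝ α) {b : ℝ}
    (h : ∀ P ∈ G, (b : EReal) ≤ a + klBits P PY) : (b : EReal) ≤ a + minKl PY G := by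
  have h0 : 0 ≤ minKl PY G := by
    refine le_sInf ?_
    rintro _ ⟨P, hP, rfl⟩
    exact klBits_nonneg (hG hP) hPY
  induction a using EReal.rec with
  | bot => exact absurd rfl ha
  | top =>
    rw [EReal.top_add_of_ne_bot (ne_of_gt (lt_of_lt_of_le (EReal.bot_lt_zero) h0))]
    exact le_top
  | coe a =>
    rw [add_comm, ← EReal.sub_le_iff_le_add (.inl (EReal.coe_ne_bot a))
      (.inl (EReal.coe_ne_top a))]
    refine le_sInf ?_
    rintro _ ⟨P, hP, rfl⟩
    rw [EReal.sub_le_iff_le_add (.inl (EReal.coe_ne_bot a)) (.inl (EReal.coe_ne_top a)), add_comm]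
    exact h P hP

include hd hc hPY in
lemma tendsto_minObjTr_gammaTr :
    Tendsto (fun lam : ℝ => minObjTr c PX PY (gammaTr c d L lam)) (𝓝[>] 0)
      (𝓝 (minObjTr c PX PY (gammaZero d L))) := by
  refine tendsto_of_le_of_eventually_le ?_ ?_
  · intro lam hlam
    refine le_sInf ?_
    rintro _ ⟨R, hR, rfl⟩
    refine (minObjTr_le_objTr hR).trans (add_le_add le_rfl (sInf_le_sInf (Set.image_mono ?_)))
    rintro P ⟨hP, h⟩
    refine ⟨hP, R, hR, ?_, h⟩
    rw [hGLR_eq hc hR.1 hR.1, glrReal_self hc hR]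
    exact_mod_cast hlam.le
  · intro b hb
    obtain ⟨δ, hδ, h⟩ := exists_pos_forall_glrReal_lt hd hc hb
    refine ⟨δ, hδ, fun lam hlam => le_sInf ?_⟩
    rintro _ ⟨Q, hQ, rfl⟩
    refine le_add_minKl (mul_klBits_ne_bot hc _ _) hPY (fun P hP => hP.1) ?_
    rintro P ⟨hP, R, hR, hle, hE⟩
    rw [hGLR_eq hc hR.1 hQ.1, EReal.coe_le_coe_iff] at hle
    obtain ⟨S, hS, rfl, rfl⟩ := exists_mem_boundedMaps hP hR hE
    exact (h S hS Q hQ (hle.trans_lt hlam)).le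

end Minimum

/-! ### Approximation by types and by admissible maps -/

/-- A pmf `p` is the limit of pmf's `k n i / n` with integer `k n i`, supported in the support of
`p`, and for which the mean of `w` is at most its mean under `p`. The numbers `n p i` are rounded
down, and what is left is put on the point of the support with the least `w`. -/
lemma exists_rounding {ι : Type*} [Fintype ι] {p : ι → ℝ} (hp : p ∈ stdSimplex ℝ ι) (w : ι → ℝ) :
    ∃ k : ℕ → ι → ℕ, (∀ n, ∑ i, k n i = n) ∧ (∀ n i, p i = 0 → k n i = 0) ∧
      (∀ n : ℕ, ∑ i, (k n i : ℝ) * w i ≤ n * ∑ i, p i * w i) ∧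
      ∀ i, Tendsto (fun n : ℕ => (k n i : ℝ) / n) atTop (𝓝 (p i)) := by
  classical
  have hsupp : (Finset.univ.filter fun i => p i ≠ 0).Nonempty := by
    by_contra h
    rw [Finset.not_nonempty_iff_eq_empty, Finset.filter_eq_empty_iff] at h
    have := hp.2
    rw [Finset.sum_eq_zero fun i hi => not_not.1 (h hi)] at this
    exact zero_ne_one this
  obtain ⟨i₀, hi₀, hmin⟩ := Finset.exists_min_image _ w hsupp
  have hpi₀ : p i₀ ≠ 0 := (Finset.mem_filter.1 hi₀).2
  have hfl : ∀ (n : ℕ) i, (⌊p i * n⌋₊ : ℝ) ≤ p i * n := fun n i =>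
    Nat.floor_le (mul_nonneg (hp.1 i) n.cast_nonneg)
  have hsum : ∀ n : ℕ, ∑ i, ⌊p i * n⌋₊ ≤ n := by
    intro n
    have : ((∑ i, ⌊p i * n⌋₊ : ℕ) : ℝ) ≤ n := by
      push_cast
      calc ∑ i, (⌊p i * n⌋₊ : ℝ) ≤ ∑ i, p i * n := Finset.sum_le_sum fun i _ => hfl n i
        _ = n := by rw [← Finset.sum_mul, hp.2, one_mul]
    exact_mod_cast this
  set r : ℕ → ℕ := fun n => n - ∑ i, ⌊p i * n⌋₊ with hr
  have hrcast : ∀ n : ℕ, (r n : ℝ) = n - ∑ i, (⌊p i * n⌋₊ : ℝ) := by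
    intro n; rw [hr]; push_cast [Nat.cast_sub (hsum n)]; rfl
  refine ⟨fun n i => ⌊p i * n⌋₊ + if i = i₀ then r n else 0, ?_, ?_, ?_, ?_⟩
  · intro n
    rw [Finset.sum_add_distrib, Finset.sum_ite_eq' Finset.univ i₀, if_pos (Finset.mem_univ _), hr]
    exact Nat.add_sub_cancel' (hsum n)
  · intro n i hi
    have : i ≠ i₀ := by rintro rfl; exact hpi₀ hi
    simp [hi, this]
  · intro n
    have hdiff : n * ∑ i, p i * w i -
        ∑ i, ((⌊p i * n⌋₊ + if i = i₀ then r n else 0 : ℕ) : ℝ) * w i =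
        ∑ i, (p i * n - ⌊p i * n⌋₊) * (w i - w i₀) := by
      have h1 : ∑ i, ((⌊p i * n⌋₊ + if i = i₀ then r n else 0 : ℕ) : ℝ) * w i =
          ∑ i, (⌊p i * n⌋₊ : ℝ) * w i + r n * w i₀ := by
        simp only [Nat.cast_add, Nat.cast_ite, Nat.cast_zero, add_mul, Finset.sum_add_distrib,
          ite_mul, zero_mul, Finset.sum_ite_eq', Finset.mem_univ, if_true]
      have h2 : ∑ i, (p i * n - ⌊p i * n⌋₊) * (w i - w i₀) =
          n * ∑ i, p i * w i - ∑ i, (⌊p i * n⌋₊ : ℝ) * w i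
            - ((∑ i, p i) * n - ∑ i, (⌊p i * n⌋₊ : ℝ)) * w i₀ := by
        rw [Finset.mul_sum, Finset.sum_mul, ← Finset.sum_sub_distrib, ← Finset.sum_sub_distrib,
          Finset.sum_mul, ← Finset.sum_sub_distrib]
        exact Finset.sum_congr rfl fun i _ => by ring
      rw [h1, h2, hp.2, hrcast]; ring
    have hnonneg : 0 ≤ ∑ i, (p i * n - ⌊p i * n⌋₊) * (w i - w i₀) := by
      refine Finset.sum_nonneg fun i _ => ?_
      by_cases hi : p i = 0
      · simp [hi]
      · exact mul_nonneg (sub_nonneg.2 (hfl n i))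
          (sub_nonneg.2 (hmin i (Finset.mem_filter.2 ⟨Finset.mem_univ i, hi⟩)))
    linarith
  · intro i
    have hlim : ∀ i, Tendsto (fun n : ℕ => (⌊p i * n⌋₊ : ℝ) / n) atTop (𝓝 (p i)) := fun i =>
      (tendsto_nat_floor_mul_div_atTop (hp.1 i)).comp tendsto_natCast_atTop_atTop
    have hrlim : Tendsto (fun n : ℕ => (r n : ℝ) / n) atTop (𝓝 0) := by
      have h1 : Tendsto (fun n : ℕ => 1 - ∑ i, (⌊p i * n⌋₊ : ℝ) / n) atTop
          (𝓝 (1 - ∑ i, p i)) :=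
        tendsto_const_nhds.sub (tendsto_finsetSum _ fun i _ => hlim i)
      rw [hp.2, sub_self] at h1
      refine h1.congr' ?_
      filter_upwards [eventually_ne_atTop 0] with n hn
      rw [hrcast, sub_div, Finset.sum_div, div_self (by exact_mod_cast hn)]
    have hite : Tendsto (fun n : ℕ => if i = i₀ then (r n : ℝ) / n else 0) atTop (𝓝 0) := by
      by_cases h : i = i₀
      · simpa only [if_pos h] using hrlim
      · simp only [if_neg h]; exact tendsto_const_nhds
    have := (hlim i).add hite
    rw [add_zero] at this
    refine this.congr fun n => ?_
    by_cases h : i = i₀ <;> simp [h, add_div]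

lemma exists_tendsto_empType {Q : α → ℝ} (hQ : Q ∈ stdSimplex ℝ α) :
    ∃ t : (n : ℕ) → Fin n → α, (∀ n, AbsCont (empType (t n)) Q) ∧
      Tendsto (fun n => empType (t n)) atTop (𝓝 Q) := by
  obtain ⟨k, h1, h2, -, h4⟩ := exists_rounding hQ 0
  choose t ht using fun n => exists_count_eq (k n) (h1 n)
  refine ⟨t, fun n a ha => ?_, ?_⟩
  · rw [empType_apply, ht, h2 n a ha]; simp
  · rw [tendsto_pi_nhds]
    intro a
    simp only [empType_apply, ht]
    exact h4 a

lemma mem_boundedMaps_of_admissible {d : α → α → ℝ} {L : ℝ} {n : ℕ} (hn : n ≠ 0)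
    {y : Fin n → α} {S : α → α → ℝ} (hS : S ∈ admissibleMaps d L n (empType y)) :
    S ∈ boundedMaps d L := by
  obtain ⟨⟨k, hk⟩, hin, hcost⟩ := hS
  refine ⟨fun i j => by rw [hk]; positivity, ?_, hcost⟩
  rw [← (empType_mem_stdSimplex hn y).2, ← hin]
  rfl

lemma exists_outMarg_eq_empType {n : ℕ} (hn : n ≠ 0) {S : α → α → ℝ} {k : α → α → ℕ}
    (hk : ∀ i j, S i j = (k i j : ℝ) / n) (h1 : ∑ i, ∑ j, S i j = 1) :
    ∃ z : Fin n → α, empType z = outMarg S := by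
  have hsum : ∑ j, ∑ i, k i j = n := by
    have : ((∑ j, ∑ i, k i j : ℕ) : ℝ) = n := by
      rw [Finset.sum_comm]
      simp only [hk, ← Finset.sum_div] at h1
      rw [div_eq_one_iff_eq (by exact_mod_cast hn)] at h1
      push_cast
      exact h1
    exact_mod_cast this
  obtain ⟨z, hz⟩ := exists_count_eq _ hsum
  refine ⟨z, ?_⟩
  funext j
  rw [empType_apply, hz, outMarg]
  simp only [hk]
  push_cast
  rw [Finset.sum_div]

lemma outMarg_mem_typesOf {d : α → α → ℝ} {L : ℝ} {n : ℕ} {y : Fin n → α} {S : α → α → ℝ}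
    (hS : S ∈ admissibleMaps d L n (empType y)) : outMarg S ∈ typesOf α n := by
  rcases eq_or_ne n 0 with rfl | hn
  · obtain ⟨⟨k, hk⟩, -⟩ := hS
    refine ⟨y, ?_⟩
    funext j
    simp [empType_apply, outMarg, hk]
  · obtain ⟨z, hz⟩ := exists_outMarg_eq_empType hn hS.1.choose_spec
      (mem_boundedMaps_of_admissible hn hS).2.1
    exact ⟨z, hz⟩

/-- A joint pmf with bounded distortion is the limit of admissible maps that are absolutely
continuous with respect to it; in particular so are their marginals. -/
lemma exists_tendsto_admissible {d : α → α → ℝ} {L : ℝ} {S : α → α → ℝ}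
    (hS : S ∈ boundedMaps d L) :
    ∃ (T : ℕ → α → α → ℝ) (y : (n : ℕ) → Fin n → α),
      (∀ n, n ≠ 0 → T n ∈ admissibleMaps d L n (empType (y n))) ∧
      (∀ n, AbsCont (outMarg (T n)) (outMarg S)) ∧
      (∀ n, AbsCont (empType (y n)) (inMarg S)) ∧
      Tendsto (fun n => outMarg (T n)) atTop (𝓝 (outMarg S)) ∧
      Tendsto (fun n => empType (y n)) atTop (𝓝 (inMarg S)) := by
  obtain ⟨h0, h1, hcost⟩ := hS
  have hp : (fun z : α × α => S z.1 z.2) ∈ stdSimplex ℝ (α × α) :=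
    ⟨fun z => h0 _ _, by rw [Fintype.sum_prod_type]; exact h1⟩
  obtain ⟨k, k1, k2, k3, k4⟩ := exists_rounding hp fun z => d z.1 z.2
  have hrow : ∀ n, ∑ i, ∑ j, k n (i, j) = n := fun n => by
    rw [← Fintype.sum_prod_type']; exact k1 n
  choose y hy using fun n => exists_count_eq (fun i => ∑ j, k n (i, j)) (hrow n)
  set T : ℕ → α → α → ℝ := fun n i j => (k n (i, j) : ℝ) / n with hT
  have hin : ∀ n, inMarg (T n) = empType (y n) := by
    intro n
    funext i
    rw [empType_apply, hy, inMarg]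
    push_cast
    rw [Finset.sum_div]
  have hlim : Tendsto T atTop (𝓝 S) := by
    rw [tendsto_pi_nhds]
    intro i
    rw [tendsto_pi_nhds]
    exact fun j => k4 (i, j)
  refine ⟨T, y, fun n hn => ⟨⟨fun i j => k n (i, j), fun i j => rfl⟩, hin n, ?_⟩, ?_, ?_,
    (continuous_outMarg.tendsto S).comp hlim, ?_⟩
  · refine le_trans ?_ hcost
    have hn' : (0 : ℝ) < n := by exact_mod_cast Nat.pos_of_ne_zero hn
    have h3 := k3 n
    rw [Fintype.sum_prod_type, Fintype.sum_prod_type, mul_comm, ← div_le_iff₀ hn'] at h3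
    refine le_trans (le_of_eq ?_) h3
    rw [mapCost, Finset.sum_div]
    refine Finset.sum_congr rfl fun i _ => ?_
    rw [Finset.sum_div]
    exact Finset.sum_congr rfl fun j _ => by rw [hT]; ring
  · intro n j hj
    have := (Finset.sum_eq_zero_iff_of_nonneg fun i _ => h0 i j).1 hj
    exact Finset.sum_eq_zero fun i hi => by
      simp [hT, k2 n (i, j) (this i hi)]
  · intro n i hi
    have := (Finset.sum_eq_zero_iff_of_nonneg fun j _ => h0 i j).1 hi
    rw [← hin]
    exact Finset.sum_eq_zero fun j hj => by
      simp [hT, k2 n (i, j) (this j hj)]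
  · simp only [← hin]
    exact (continuous_inMarg.tendsto S).comp hlim

/-! ### Exponential bounds on probabilities -/

/-- The binary logarithm of the polynomial factor `((n+1)(N+1)) ^ |α|` that bounds the number of
pairs of types; for single types `N` is `0`. -/
noncomputable def polyLog (α : Type*) [Fintype α] (n N : ℕ) : ℝ :=
  (Fintype.card α : ℝ) * Real.logb 2 (((n : ℝ) + 1) * ((N : ℝ) + 1))

lemma rpow_polyLog (n N : ℕ) :
    (2 : ℝ) ^ polyLog α n N =
      ((n : ℝ) + 1) ^ Fintype.card α * ((N : ℝ) + 1) ^ Fintype.card α := by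
  rw [polyLog, mul_comm, Real.rpow_mul two_pos.le,
    Real.rpow_logb two_pos (by norm_num) (by positivity), Real.rpow_natCast, mul_pow]

lemma expRate_antitone (n : ℕ) {p q : ℝ} (hp : 0 ≤ p) (hpq : p ≤ q) :
    expRate n q ≤ expRate n p := by
  unfold expRate
  rcases hp.eq_or_lt with h0 | h0
  · rw [if_pos h0.symm]; exact le_top
  · rw [if_neg h0.ne', if_neg (h0.trans_le hpq).ne', EReal.coe_le_coe_iff, neg_mul, neg_mul,
      neg_le_neg_iff]
    gcongr
    exact one_lt_two

lemma expRate_rpow {n : ℕ} (hn : n ≠ 0) (b g : ℝ) :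
    expRate n ((2 : ℝ) ^ (g - n * b)) = ((b - g / n : ℝ) : EReal) := by
  have hn' : (n : ℝ) ≠ 0 := by exact_mod_cast hn
  rw [expRate, if_neg (by positivity), Real.logb_rpow two_pos (by norm_num)]
  congr 1
  field_simp
  ring

lemma le_expRate {n : ℕ} (hn : n ≠ 0) {p b g : ℝ} (hp : 0 ≤ p)
    (h : p ≤ (2 : ℝ) ^ (g - n * b)) : ((b - g / n : ℝ) : EReal) ≤ expRate n p := by
  rw [← expRate_rpow hn]
  exact expRate_antitone n hp h

lemma expRate_le {n : ℕ} (hn : n ≠ 0) {p b g : ℝ} (h : (2 : ℝ) ^ (g - n * b) ≤ p) :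
    expRate n p ≤ ((b - g / n : ℝ) : EReal) := by
  rw [← expRate_rpow hn]
  exact expRate_antitone n (by positivity) h

lemma seqProb_le_of_le {n : ℕ} (hn : n ≠ 0) {P : α → ℝ} (hP : ∀ a, 0 ≤ P a) (x : Fin n → α)
    {B : ℝ} (hB : AbsCont (empType x) P → B ≤ n * klReal (empType x) P) :
    seqProb P x ≤ seqProb (empType x) x * (2 : ℝ) ^ (-B) := by
  have h0 := seqProb_nonneg (empType_mem_stdSimplex hn x).1 x
  by_cases h : seqProb P x = 0
  · rw [h]; positivity
  · have hac := absCont_empType_of_seqProb_ne_zero h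
    rw [seqProb_eq hn hP hac]
    gcongr
    · exact one_le_two
    · exact hB hac

open Classical in
/-- A set of sequences whose types have divergence at least `B / n` from `P` has probability at
most `(n+1) ^ |α| 2 ^ (-B)`. -/
lemma sum_seqProb_le {n : ℕ} (hn : n ≠ 0) {P : α → ℝ} (hP : ∀ a, 0 ≤ P a)
    (A : (Fin n → α) → Prop) {B : ℝ}
    (hB : ∀ x, A x → AbsCont (empType x) P → B ≤ n * klReal (empType x) P) :
    ∑ x, (if A x then seqProb P x else 0) ≤ (2 : ℝ) ^ (polyLog α n 0 - B) := by
  calc ∑ x, (if A x then seqProb P x else 0)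
      ≤ ∑ x : Fin n → α, seqProb (empType x) x * (2 : ℝ) ^ (-B) := by
        refine Finset.sum_le_sum fun x _ => ?_
        split_ifs with h
        · exact seqProb_le_of_le hn hP x (hB x h)
        · have := seqProb_nonneg (empType_mem_stdSimplex hn x).1 x
          positivity
    _ ≤ ((n : ℝ) + 1) ^ Fintype.card α * (2 : ℝ) ^ (-B) := by
        rw [← Finset.sum_mul]
        exact mul_le_mul_of_nonneg_right (sum_seqProb_empType_le hn) (by positivity)
    _ = _ := by
        rw [sub_eq_add_neg, Real.rpow_add two_pos, rpow_polyLog]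
        simp

open Classical in
/-- The analogue of `sum_seqProb_le` for pairs of independent sequences. -/
lemma sum_sum_seqProb_le {n N : ℕ} (hn : n ≠ 0) (hN : N ≠ 0) {P Q : α → ℝ} (hP : ∀ a, 0 ≤ P a)
    (hQ : ∀ a, 0 ≤ Q a) (A : (Fin n → α) → (Fin N → α) → Prop) {B : ℝ}
    (hB : ∀ x t, A x t → AbsCont (empType x) P → AbsCont (empType t) Q →
      B ≤ n * klReal (empType x) P + N * klReal (empType t) Q) :
    ∑ x, ∑ t, (if A x t then seqProb P x * seqProb Q t else 0) ≤
      (2 : ℝ) ^ (polyLog α n N - B) := by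
  calc ∑ x, ∑ t, (if A x t then seqProb P x * seqProb Q t else 0)
      ≤ ∑ x : Fin n → α, ∑ t : Fin N → α,
          seqProb (empType x) x * seqProb (empType t) t * (2 : ℝ) ^ (-B) := by
        refine Finset.sum_le_sum fun x _ => Finset.sum_le_sum fun t _ => ?_
        have h1 := seqProb_nonneg (empType_mem_stdSimplex hn x).1 x
        have h2 := seqProb_nonneg (empType_mem_stdSimplex hN t).1 t
        split_ifs with h
        · by_cases hx : seqProb P x = 0
          · rw [hx, zero_mul]; positivity
          · have hac := absCont_empType_of_seqProb_ne_zero hx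
            have := seqProb_le_of_le hN hQ t (B := B - n * klReal (empType x) P)
              fun h' => by linarith [hB x t h hac h']
            calc seqProb P x * seqProb Q t
                ≤ (seqProb (empType x) x * (2 : ℝ) ^ (-(n * klReal (empType x) P))) *
                  (seqProb (empType t) t * (2 : ℝ) ^ (-(B - n * klReal (empType x) P))) := by
                  rw [seqProb_eq hn hP hac]
                  gcongr
              _ = seqProb (empType x) x * seqProb (empType t) t *
                  ((2 : ℝ) ^ (-(n * klReal (empType x) P)) *
                    (2 : ℝ) ^ (-(B - n * klReal (empType x) P))) := by ring
              _ = _ := by rw [← Real.rpow_add two_pos]; ring_nf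
        · positivity
    _ = (∑ x : Fin n → α, seqProb (empType x) x) * (∑ t : Fin N → α, seqProb (empType t) t) *
          (2 : ℝ) ^ (-B) := by
        rw [Finset.sum_mul_sum, Finset.sum_mul]
        simp only [Finset.sum_mul]
    _ ≤ (((n : ℝ) + 1) ^ Fintype.card α * ((N : ℝ) + 1) ^ Fintype.card α) * (2 : ℝ) ^ (-B) := by
        have : 0 ≤ ∑ t : Fin N → α, seqProb (empType t) t := Finset.sum_nonneg fun t _ =>
          seqProb_nonneg (empType_mem_stdSimplex hN t).1 t
        gcongr
        · exact sum_seqProb_empType_le hn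
        · exact sum_seqProb_empType_le hN
    _ = _ := by rw [sub_eq_add_neg, Real.rpow_add two_pos, rpow_polyLog]

open Classical in
/-- A set that contains a type class has at least the probability of that class. -/
lemma le_sum_seqProb {n : ℕ} (hn : n ≠ 0) {P : α → ℝ} (hP : ∀ a, 0 ≤ P a)
    (A : (Fin n → α) → Prop) (x₀ : Fin n → α) (h : AbsCont (empType x₀) P)
    (hA : ∀ x, empType x = empType x₀ → A x) :
    (2 : ℝ) ^ (-polyLog α n 0 - n * klReal (empType x₀) P) ≤
      ∑ x, (if A x then seqProb P x else 0) := by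
  have h1 := rpow_le_mul_sum_typeClass hn hP x₀ h
  rw [sub_eq_add_neg, Real.rpow_add two_pos, Real.rpow_neg two_pos.le, rpow_polyLog,
    inv_mul_le_iff₀ (by positivity)]
  simp only [CharP.cast_eq_zero, zero_add, one_pow, mul_one]
  refine h1.trans (mul_le_mul_of_nonneg_left ?_ (by positivity))
  rw [Finset.sum_filter]
  refine Finset.sum_le_sum fun x _ => ?_
  have h0 := seqProb_nonneg hP x
  by_cases hx : count x = count x₀
  · rw [if_pos hx, if_pos (hA x ((empType_eq_iff hn _ _).2 hx))]
  · rw [if_neg hx]; split_ifs; exacts [h0, le_rfl]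

open Classical in
/-- The analogue of `le_sum_seqProb` for pairs of independent sequences. -/
lemma le_sum_sum_seqProb {n N : ℕ} (hn : n ≠ 0) (hN : N ≠ 0) {P Q : α → ℝ} (hP : ∀ a, 0 ≤ P a)
    (hQ : ∀ a, 0 ≤ Q a) (A : (Fin n → α) → (Fin N → α) → Prop) (x₀ : Fin n → α)
    (t₀ : Fin N → α) (h : AbsCont (empType x₀) P) (h' : AbsCont (empType t₀) Q)
    (hA : ∀ x t, empType x = empType x₀ → empType t = empType t₀ → A x t) :
    (2 : ℝ) ^ (-polyLog α n N - (n * klReal (empType x₀) P + N * klReal (empType t₀) Q)) ≤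
      ∑ x, ∑ t, (if A x t then seqProb P x * seqProb Q t else 0) := by
  have h1 := rpow_le_mul_sum_typeClass hn hP x₀ h
  have h2 := rpow_le_mul_sum_typeClass hN hQ t₀ h'
  rw [sub_eq_add_neg, Real.rpow_add two_pos, Real.rpow_neg two_pos.le, rpow_polyLog,
    inv_mul_le_iff₀ (by positivity), neg_add, Real.rpow_add two_pos]
  refine (mul_le_mul h1 h2 (by positivity) ((by positivity : (0 : ℝ) ≤ _).trans h1)).trans ?_
  rw [mul_mul_mul_comm]
  refine mul_le_mul_of_nonneg_left ?_ (by positivity)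
  rw [Finset.sum_filter, Finset.sum_filter, Finset.sum_mul_sum]
  refine Finset.sum_le_sum fun x _ => Finset.sum_le_sum fun t _ => ?_
  have h0 := mul_nonneg (seqProb_nonneg hP x) (seqProb_nonneg hQ t)
  by_cases hx : count x = count x₀
  · by_cases ht : count t = count t₀
    · rw [if_pos hx, if_pos ht,
        if_pos (hA x t ((empType_eq_iff hn _ _).2 hx) ((empType_eq_iff hN _ _).2 ht))]
    · rw [if_neg ht, mul_zero]; split_ifs; exacts [h0, le_rfl]
  · rw [if_neg hx, zero_mul]; split_ifs; exacts [h0, le_rfl]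

/-! ### Asymptotics of the lengths -/

lemma tendsto_logb_succ_div :
    Tendsto (fun n : ℕ => Real.logb 2 ((n : ℝ) + 1) / n) atTop (𝓝 0) := by
  have h1 : Tendsto (fun n : ℕ => Real.log ((n : ℝ) + 1) / ((n : ℝ) + 1)) atTop (𝓝 0) := by
    have h := Real.isLittleO_log_id_atTop.tendsto_div_nhds_zero.comp
      (tendsto_atTop_add_const_right _ (1 : ℝ) (tendsto_natCast_atTop_atTop (R := ℝ)))
    exact h
  have h2 : Tendsto (fun n : ℕ => 1 + 1 / (n : ℝ)) atTop (𝓝 (1 + 0)) :=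
    tendsto_const_nhds.add tendsto_one_div_atTop_nhds_zero_nat
  have h3 := (h1.mul h2).div_const (Real.log 2)
  rw [zero_mul, zero_div] at h3
  refine h3.congr' ?_
  filter_upwards [eventually_ne_atTop 0] with n hn
  have hn' : (n : ℝ) ≠ 0 := by exact_mod_cast hn
  have : (n : ℝ) + 1 ≠ 0 := by positivity
  rw [Real.logb]
  field_simp

lemma tendsto_floor_mul_atTop {c : ℝ} (hc : 0 < c) :
    Tendsto (fun n : ℕ => ⌊c * n⌋₊) atTop atTop :=
  tendsto_nat_floor_atTop.comp (tendsto_natCast_atTop_atTop.const_mul_atTop hc)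

lemma tendsto_floor_mul_div {c : ℝ} (hc : 0 < c) :
    Tendsto (fun n : ℕ => (⌊c * n⌋₊ : ℝ) / n) atTop (𝓝 c) :=
  (tendsto_nat_floor_mul_div_atTop hc.le).comp tendsto_natCast_atTop_atTop

lemma tendsto_polyLog_zero_div (α : Type*) [Fintype α] :
    Tendsto (fun n : ℕ => polyLog α n 0 / n) atTop (𝓝 0) := by
  have := tendsto_logb_succ_div.const_mul (Fintype.card α : ℝ)
  rw [mul_zero] at this
  refine this.congr fun n => ?_
  rw [polyLog]; simp [mul_div_assoc]

lemma tendsto_polyLog_div (α : Type*) [Fintype α] {c : ℝ} (hc : 0 < c) :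
    Tendsto (fun n : ℕ => polyLog α n ⌊c * n⌋₊ / n) atTop (𝓝 0) := by
  have h1 := tendsto_logb_succ_div
  have h2 := (h1.comp (tendsto_floor_mul_atTop hc)).mul (tendsto_floor_mul_div hc)
  have h3 := (h1.add h2).const_mul (Fintype.card α : ℝ)
  rw [zero_mul, add_zero, mul_zero] at h3
  refine h3.congr' ?_
  filter_upwards [eventually_ne_atTop 0, (tendsto_floor_mul_atTop hc).eventually_ne_atTop 0]
    with n hn hN
  have hn' : (n : ℝ) ≠ 0 := by exact_mod_cast hn
  have hN' : (⌊c * n⌋₊ : ℝ) ≠ 0 := by exact_mod_cast hN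
  rw [polyLog, Real.logb_mul (by positivity) (by positivity)]
  simp only [Function.comp_apply]
  rw [div_mul_div_cancel₀ hN', ← add_div, mul_div_assoc]

lemma tendsto_polyLog_atTop [Nonempty α] (c : ℝ) :
    Tendsto (fun n : ℕ => polyLog α n ⌊c * n⌋₊) atTop atTop := by
  have h1 : Tendsto (fun n : ℕ => Real.logb 2 ((n : ℝ) + 1)) atTop atTop :=
    (Real.tendsto_logb_atTop one_lt_two).comp
      (tendsto_atTop_add_const_right _ (1 : ℝ) tendsto_natCast_atTop_atTop)
  refine tendsto_atTop_mono (fun n => ?_) h1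
  have hcard : (1 : ℝ) ≤ Fintype.card α := by exact_mod_cast Fintype.card_pos
  have hle : Real.logb 2 ((n : ℝ) + 1) ≤
      Real.logb 2 (((n : ℝ) + 1) * ((⌊c * n⌋₊ : ℝ) + 1)) := by
    refine Real.logb_le_logb_of_le one_lt_two (by positivity) ?_
    exact le_mul_of_one_le_right (by positivity) (by linarith [Nat.cast_nonneg (α := ℝ) ⌊c * n⌋₊])
  have h0 : 0 ≤ Real.logb 2 ((n : ℝ) + 1) :=
    Real.logb_nonneg one_lt_two (by linarith [Nat.cast_nonneg (α := ℝ) n])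
  exact hle.trans (le_mul_of_one_le_left (h0.trans hle) hcard)

/-- The polynomial factor in the acceptance region at the equilibrium outweighs the effect of
rounding the length of the training sequence: from some `n` on, acceptance implies `h_c < λ`. -/
lemma eventually_glrReal_lt [Nonempty α] {c : ℝ} (hc : 0 < c) (lam : ℝ) :
    ∀ᶠ n : ℕ in atTop, ∀ P ∈ stdSimplex ℝ α, ∀ Q ∈ stdSimplex ℝ α,
      glrReal ((⌊c * n⌋₊ : ℝ) / n) P Q < lam - polyLog α n ⌊c * n⌋₊ / n →
        glrReal c P Q < lam := by
  have hlim : Tendsto (fun n : ℕ => Real.logb 2 ((1 + (⌊c * n⌋₊ : ℝ) / n) / ((⌊c * n⌋₊ : ℝ) / n)))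
      atTop (𝓝 (Real.logb 2 ((1 + c) / c))) := by
    have h1 := tendsto_floor_mul_div hc
    have h2 := (tendsto_const_nhds (x := (1 : ℝ))).add h1 |>.div h1 hc.ne'
    exact (Real.continuousAt_log (by positivity)).tendsto.comp h2 |>.div_const _
  filter_upwards [eventually_ne_atTop 0, (tendsto_floor_mul_atTop hc).eventually_ne_atTop 0,
    hlim.eventually_lt_const (lt_add_one _),
    (tendsto_polyLog_atTop (α := α) c).eventually_ge_atTop
      (max (Real.logb 2 ((1 + c) / c) + 1) 0)] with n hn hN h1 h2 P hP Q hQ h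
  have hn' : (0 : ℝ) < n := by exact_mod_cast Nat.pos_of_ne_zero hn
  have hN' : (0 : ℝ) < ⌊c * n⌋₊ := by exact_mod_cast Nat.pos_of_ne_zero hN
  have hle : (⌊c * n⌋₊ : ℝ) / n ≤ c := by
    rw [div_le_iff₀ hn']; exact Nat.floor_le (by positivity)
  have h3 := glrReal_le_glrReal_add (div_pos hN' hn') hle hP hQ
  have h4 : c - (⌊c * n⌋₊ : ℝ) / n ≤ 1 / n := by
    rw [sub_le_iff_le_add, ← add_div, le_div_iff₀ hn']
    linarith [Nat.lt_floor_add_one (c * (n : ℝ))]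
  have h5 : (c - (⌊c * n⌋₊ : ℝ) / n) *
      Real.logb 2 ((1 + (⌊c * n⌋₊ : ℝ) / n) / ((⌊c * n⌋₊ : ℝ) / n)) ≤
        1 / n * polyLog α n ⌊c * n⌋₊ := by
    refine mul_le_mul h4 (h1.le.trans ((le_max_left _ _).trans h2)) ?_ (by positivity)
    refine Real.logb_nonneg one_lt_two ?_
    rw [le_div_iff₀ (by positivity)]; linarith
  rw [one_div_mul_eq_div] at h5
  linarith

/-! ### The equilibrium of the game with training data -/

lemma nonempty_of_mem_stdSimplex {P : α → ℝ} (hP : P ∈ stdSimplex ℝ α) :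
    Nonempty α := by
  by_contra h
  rw [not_nonempty_iff] at h
  have := hP.2
  simp at this

lemma finite_admissibleMaps (d : α → α → ℝ) (L : ℝ) {n : ℕ} (y : Fin n → α) :
    (admissibleMaps d L n (empType y)).Finite := by
  classical
  refine ((Set.finite_Icc (0 : α → α → ℕ) (fun _ _ => n)).image
    (fun k i j => (k i j : ℝ) / n)).subset ?_
  intro S hS
  rcases eq_or_ne n 0 with rfl | hn
  · obtain ⟨⟨k, hk⟩, -⟩ := hS
    refine ⟨0, ⟨le_rfl, fun _ _ => le_rfl⟩, ?_⟩
    funext i j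
    simp [hk]
  · have hb := mem_boundedMaps_of_admissible hn hS
    obtain ⟨⟨k, hk⟩, -⟩ := hS
    refine ⟨k, ⟨fun _ _ => Nat.zero_le _, fun i j => ?_⟩, by funext i j; rw [hk]⟩
    have h1 := le_one_of_sum_eq_one hb.1 hb.2.1 i j
    have hn' : (0 : ℝ) < n := by exact_mod_cast Nat.pos_of_ne_zero hn
    rw [hk, div_le_one hn'] at h1
    exact_mod_cast h1

lemma nonempty_admissibleMaps {d : α → α → ℝ} (hself : ∀ i, d i i = 0) {L : ℝ} (hL : 0 ≤ L)
    {n : ℕ} (y : Fin n → α) : (admissibleMaps d L n (empType y)).Nonempty := by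
  classical
  refine ⟨fun i j => if i = j then empType y i else 0,
    ⟨fun i j => if i = j then count y i else 0, fun i j => ?_⟩, ?_, ?_⟩
  · dsimp only
    split_ifs
    · rw [empType_apply]
    · simp
  · funext i; simp [inMarg]
  · simpa [mapCost, hself] using hL

lemma exists_isEqAttackTr {d : α → α → ℝ} (hself : ∀ i, d i i = 0) {L : ℝ} (hL : 0 ≤ L)
    (n N : ℕ) : ∃ S, IsEqAttackTr (α := α) d L n N S := by
  choose S hS hmin using fun (y : Fin n → α) (t : Fin N → α) =>
    Set.exists_min_image (admissibleMaps d L n (empType y))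
      (fun S => hGLR ((N : ℝ) / n) (outMarg S) (empType t)) (finite_admissibleMaps d L y)
      (nonempty_admissibleMaps hself hL y)
  exact ⟨S, hS, hmin⟩

omit [Fintype α] in
lemma empType_mem_typesOf {n : ℕ} (x : Fin n → α) : empType x ∈ typesOf α n := ⟨x, rfl⟩

open Classical in
lemma falsePosTr_eq {n N : ℕ} (P : α → ℝ) {Λ : Set ((α → ℝ) × (α → ℝ))}
    {A : (Fin n → α) → (Fin N → α) → Prop} (hA : ∀ x t, A x t ↔ (empType x, empType t) ∉ Λ) :
    falsePosTr n N P Λ = ∑ x, ∑ t, if A x t then seqProb P x * seqProb P t else 0 :=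
  Finset.sum_congr rfl fun x _ => Finset.sum_congr rfl fun t _ => by
    by_cases h : (empType x, empType t) ∈ Λ
    · rw [if_pos h, if_neg (by rwa [hA, not_not])]
    · rw [if_neg h, if_pos ((hA x t).2 h)]

open Classical in
lemma falsePosKs_eq {n : ℕ} (P : α → ℝ) {Λ : Set (α → ℝ)} {A : (Fin n → α) → Prop}
    (hA : ∀ x, A x ↔ empType x ∉ Λ) :
    falsePosKs n P Λ = ∑ x, if A x then seqProb P x else 0 :=
  Finset.sum_congr rfl fun x _ => by
    by_cases h : empType x ∈ Λ
    · rw [if_pos h, if_neg (by rwa [hA, not_not])]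
    · rw [if_neg h, if_pos ((hA x).2 h)]

/-- Membership in the acceptance region at the equilibrium, in terms of real numbers. -/
lemma mem_eqRegionTr_iff {n N : ℕ} (hn : n ≠ 0) (hN : N ≠ 0) {lam : ℝ} {P Q : α → ℝ}
    (hP : P ∈ typesOf α n) (hQ : Q ∈ typesOf α N) :
    (P, Q) ∈ eqRegionTr α n N lam ↔ glrReal ((N : ℝ) / n) P Q < lam - polyLog α n N / n := by
  have hc : (0 : ℝ) < (N : ℝ) / n :=
    div_pos (by exact_mod_cast Nat.pos_of_ne_zero hN) (by exact_mod_cast Nat.pos_of_ne_zero hn)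
  have hP0 : ∀ a, 0 ≤ P a := by
    obtain ⟨x, rfl⟩ := hP; exact (empType_mem_stdSimplex hn x).1
  have hQ0 : ∀ a, 0 ≤ Q a := by
    obtain ⟨x, rfl⟩ := hQ; exact (empType_mem_stdSimplex hN x).1
  simp only [eqRegionTr, Set.mem_ofPred_eq, hP, hQ, true_and]
  rw [hGLR_eq hc hP0 hQ0, EReal.coe_lt_coe_iff]
  rfl

lemma falseNegTr_nonneg {PX PY : α → ℝ} (hPX : ∀ a, 0 ≤ PX a) (hPY : ∀ a, 0 ≤ PY a) {n N : ℕ}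
    (Λ : Set ((α → ℝ) × (α → ℝ))) (S : (Fin n → α) → (Fin N → α) → (α → α → ℝ)) :
    0 ≤ falseNegTr PX PY Λ S := by
  refine Finset.sum_nonneg fun y _ => Finset.sum_nonneg fun t _ => ?_
  split_ifs
  · exact mul_nonneg (seqProb_nonneg hPY y) (seqProb_nonneg hPX t)
  · exact le_rfl

lemma falseNegTr_mono {PX PY : α → ℝ} (hPX : ∀ a, 0 ≤ PX a) (hPY : ∀ a, 0 ≤ PY a) {n N : ℕ}
    {Λ Λ' : Set ((α → ℝ) × (α → ℝ))} (h : Λ ⊆ Λ')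
    (S : (Fin n → α) → (Fin N → α) → (α → α → ℝ)) :
    falseNegTr PX PY Λ S ≤ falseNegTr PX PY Λ' S := by
  refine Finset.sum_le_sum fun y _ => Finset.sum_le_sum fun t _ => ?_
  have h0 := mul_nonneg (seqProb_nonneg hPY y) (seqProb_nonneg hPX t)
  split_ifs with h1 h2 h2
  exacts [le_rfl, absurd (h h1) h2, h0, le_rfl]

lemma le_liminf_of_forall_real {f : ℕ → EReal} {v : EReal} {g : ℕ → ℝ}
    (hg : Tendsto g atTop (𝓝 0))
    (h : ∀ b : ℝ, (b : EReal) < v → ∀ᶠ n in atTop, ((b - g n : ℝ) : EReal) ≤ f n) :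
    v ≤ liminf f atTop := by
  refine le_of_forall_lt fun a ha => ?_
  obtain ⟨b, hab, hbv⟩ := EReal.lt_iff_exists_real_btwn.1 ha
  refine hab.trans_le ?_
  have hlim : Tendsto (fun n => ((b - g n : ℝ) : EReal)) atTop (𝓝 (b : EReal)) := by
    have := (tendsto_const_nhds (x := b)).sub hg
    rw [sub_zero] at this
    exact (continuous_coe_real_ereal.tendsto _).comp this
  rw [← hlim.liminf_eq]
  exact liminf_le_liminf (h b hbv)

section Game

variable {d : α → α → ℝ} (hd : ∀ i j, 0 ≤ d i j) (hself : ∀ i, d i i = 0)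
  {PX PY : α → ℝ} (hPX : PX ∈ stdSimplex ℝ α) (hPY : PY ∈ stdSimplex ℝ α)
  {c : ℝ} (hc : 0 < c) {L : ℝ} (hL : 0 ≤ L)

include hPX hPY hc in
/-- Against the acceptance region of the equilibrium, no attack achieves a smaller exponent than
`eqExp`. -/
lemma eqExp_le_liminf (lam : ℝ) (S : (n : ℕ) → (Fin n → α) → (Fin ⌊c * n⌋₊ → α) → (α → α → ℝ))
    (hS : ∀ n, S n ∈ attackerTr d L n ⌊c * n⌋₊) :
    eqExp c d L PX PY lam ≤
      liminf (fun n : ℕ => expRate n (falseNegTr PX PY (eqRegionTr α n ⌊c * n⌋₊ lam) (S n)))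
        atTop := by
  have := nonempty_of_mem_stdSimplex hPX
  obtain ⟨K, hK0, hK⟩ := exists_klReal_le PX
  refine le_liminf_of_forall_real (g := fun n => (polyLog α n ⌊c * n⌋₊ + K) / n) ?_ ?_
  · have := (tendsto_polyLog_div α hc).add (tendsto_const_div_atTop_nhds_zero_nat K)
    rw [add_zero] at this
    exact this.congr fun n => (add_div _ _ _).symm
  intro b hb
  filter_upwards [eventually_ne_atTop 0, (tendsto_floor_mul_atTop hc).eventually_ne_atTop 0,
    eventually_glrReal_lt (α := α) hc lam] with n hn hN hglr
  refine le_expRate hn (falseNegTr_nonneg hPX.1 hPY.1 _ _) ?_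
  rw [add_sub_assoc, ← neg_sub, ← sub_eq_add_neg]
  refine sum_sum_seqProb_le hn hN hPY.1 hPX.1
    (fun y t => (outMarg (S n y t), empType t) ∈ eqRegionTr α n ⌊c * n⌋₊ lam) ?_
  intro y t hA hy ht
  have hb' := mem_boundedMaps_of_admissible hn (hS n y t)
  have hin : inMarg (S n y t) = empType y := (hS n y t).2.1
  have hQ := empType_mem_stdSimplex hN t
  have hout := outMarg_mem_stdSimplex hb'.1 hb'.2.1
  rw [mem_eqRegionTr_iff hn hN hA.1 hA.2.1] at hA
  have hle : eqExp c d L PX PY lam ≤ pairExp c PX PY (S n y t) (empType t) :=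
    sInf_le ⟨_, hb', _, hQ, hglr _ hout _ hQ hA, rfl⟩
  rw [pairExp_of_absCont ht (hin ▸ hy), hin] at hle
  have h1 : b < c * klReal (empType t) PX + klReal (empType y) PY := by
    exact_mod_cast hb.trans_le hle
  have h2 := hK _ hQ
  have h3 := klReal_nonneg hQ hPX ht
  have h4 := Nat.lt_floor_add_one (c * (n : ℝ))
  have hn' : (0 : ℝ) < n := by exact_mod_cast Nat.pos_of_ne_zero hn
  -- Rounding down `c n` costs at most `D(Q‖PX) ≤ K` in the exponent.
  nlinarith [mul_le_mul_of_nonneg_left h1.le hn'.le, mul_le_mul_of_nonneg_right h4.le h3]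

include hPX hPY hc in
/-- The attack of the equilibrium achieves an exponent of at most `eqExp`. -/
lemma limsup_le_eqExp (lam : ℝ)
    (S : (n : ℕ) → (Fin n → α) → (Fin ⌊c * n⌋₊ → α) → (α → α → ℝ))
    (hS : ∀ n, IsEqAttackTr d L n ⌊c * n⌋₊ (S n)) :
    limsup (fun n : ℕ => expRate n (falseNegTr PX PY (eqRegionTr α n ⌊c * n⌋₊ lam) (S n)))
        atTop ≤ eqExp c d L PX PY lam := by
  refine le_sInf ?_
  rintro _ ⟨T, hT, Q, hQ, hlt, rfl⟩
  by_cases htop : pairExp c PX PY T Q = ⊤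
  · rw [htop]; exact le_top
  obtain ⟨hac1, hac2⟩ := absCont_of_pairExp_ne_top hc htop
  rw [pairExp_of_absCont hac1 hac2]
  obtain ⟨T', y₀, hadm, -, hy, hout, hin⟩ := exists_tendsto_admissible hT
  obtain ⟨t₀, ht, htlim⟩ := exists_tendsto_empType hQ
  have htlim' := htlim.comp (tendsto_floor_mul_atTop hc)
  have hexp : Tendsto (fun n : ℕ => klReal (empType (y₀ n)) PY +
      (⌊c * n⌋₊ : ℝ) / n * klReal (empType (t₀ ⌊c * n⌋₊)) PX + polyLog α n ⌊c * n⌋₊ / n) atTop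
      (𝓝 (klReal (inMarg T) PY + c * klReal Q PX + 0)) :=
    ((((continuous_klReal PY).tendsto _).comp hin).add ((tendsto_floor_mul_div hc).mul
      (((continuous_klReal PX).tendsto _).comp htlim'))).add (tendsto_polyLog_div α hc)
  rw [add_zero, add_comm] at hexp
  have hglr : Tendsto (fun n : ℕ =>
      glrReal ((⌊c * n⌋₊ : ℝ) / n) (outMarg (T' n)) (empType (t₀ ⌊c * n⌋₊)) +
        polyLog α n ⌊c * n⌋₊ / n) atTop (𝓝 (glrReal c (outMarg T) Q + 0)) := by
    refine Tendsto.add ?_ (tendsto_polyLog_div α hc)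
    have h1 := (tendsto_floor_mul_div hc).prodMk_nhds (hout.prodMk_nhds htlim')
    have h2 := (continuousAt_glrReal hc (outMarg T) Q).tendsto.comp h1
    exact h2
  rw [add_zero] at hglr
  have hexp' := (continuous_coe_real_ereal.tendsto _).comp hexp
  rw [← hexp'.limsup_eq]
  refine limsup_le_limsup ?_
  filter_upwards [eventually_ne_atTop 0, (tendsto_floor_mul_atTop hc).eventually_ne_atTop 0,
    hglr.eventually_lt_const hlt] with n hn hN hlt'
  have hn' : (n : ℝ) ≠ 0 := by exact_mod_cast hn
  have hacc : ∀ y t, empType y = empType (y₀ n) → empType t = empType (t₀ ⌊c * n⌋₊) →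
      (outMarg (S n y t), empType t) ∈ eqRegionTr α n ⌊c * n⌋₊ lam := by
    intro y t hy' ht'
    have hadm' := hadm n hn
    rw [← hy'] at hadm'
    have h1 := (hS n).2 y t (T' n) hadm'
    have h2 : (outMarg (T' n), empType t) ∈ eqRegionTr α n ⌊c * n⌋₊ lam := by
      rw [mem_eqRegionTr_iff hn hN (outMarg_mem_typesOf hadm') (empType_mem_typesOf t), ht']
      linarith
    exact ⟨outMarg_mem_typesOf ((hS n).1 y t), ⟨t, rfl⟩, h1.trans_lt h2.2.2⟩
  have hlow := le_sum_sum_seqProb hn hN hPY.1 hPX.1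
    (fun y t => (outMarg (S n y t), empType t) ∈ eqRegionTr α n ⌊c * n⌋₊ lam) (y₀ n) (t₀ ⌊c * n⌋₊)
    (fun a ha => hy n a (hac2 a ha)) (fun a ha => ht _ a (hac1 a ha)) hacc
  have hexpn : -polyLog α n ⌊c * n⌋₊ - (n * klReal (empType (y₀ n)) PY +
      ⌊c * n⌋₊ * klReal (empType (t₀ ⌊c * n⌋₊)) PX) =
      -polyLog α n ⌊c * n⌋₊ - n * (klReal (empType (y₀ n)) PY +
        (⌊c * n⌋₊ : ℝ) / n * klReal (empType (t₀ ⌊c * n⌋₊)) PX) := by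
    generalize ⌊c * n⌋₊ = N
    field_simp
  rw [hexpn] at hlow
  refine (expRate_le hn hlow).trans (le_of_eq ?_)
  rw [neg_div, sub_neg_eq_add]
  rfl

include hself hPX hPY hc hL in
lemma isFalseNegExpTr_eqExp (lam : ℝ) :
    IsFalseNegExpTr c d L PX PY lam (eqExp c d L PX PY lam) :=
  ⟨fun n => exists_isEqAttackTr hself hL n _, fun S hS =>
    tendsto_of_le_liminf_of_limsup_le (eqExp_le_liminf hPX hPY hc lam S fun n => (hS n).1)
      (limsup_le_eqExp hPX hPY hc lam S hS)⟩

/-! ### Strategies of the defender -/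

/-- Every strategy of the defender accepts the pairs in the acceptance region of the equilibrium:
under the mixture `U` of a rejected pair of types, the false positive probability is at least
`((n+1)(N+1)) ^ (-|α|) 2 ^ (-n h)`. -/
lemma eqRegionTr_subset {n N : ℕ} (hn : n ≠ 0) (hN : N ≠ 0) {lam : ℝ}
    {Λ : Set ((α → ℝ) × (α → ℝ))} (hΛ : Λ ∈ defenderTr α n N lam) :
    eqRegionTr α n N lam ⊆ Λ := by
  rintro ⟨P, Q⟩ hPQ
  by_contra hnot
  have hn' : (0 : ℝ) < n := by exact_mod_cast Nat.pos_of_ne_zero hn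
  have hcpos : (0 : ℝ) < (N : ℝ) / n := div_pos (by exact_mod_cast Nat.pos_of_ne_zero hN) hn'
  have hglr := (mem_eqRegionTr_iff hn hN hPQ.1 hPQ.2.1).1 hPQ
  obtain ⟨⟨x, hx⟩, ⟨t, ht⟩, -⟩ := hPQ
  dsimp only at hx ht
  subst hx ht
  have hP := empType_mem_stdSimplex hn x
  have hQ := empType_mem_stdSimplex hN t
  have hU := mix_mem_stdSimplex hcpos hP hQ
  have hlow := le_sum_sum_seqProb hn hN hU.1 hU.1 (fun x t => (empType x, empType t) ∉ Λ) x t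
    (absCont_mix_left hcpos hP.1 hQ.1) (absCont_mix_right hcpos hP.1 hQ.1)
    (fun x' t' hx' ht' => by rwa [hx', ht'])
  have hup := hΛ.2 _ hU
  rw [falsePosTr_eq _ fun _ _ => Iff.rfl] at hup
  have h := hlow.trans hup
  rw [Real.rpow_le_rpow_left_iff one_lt_two] at h
  rw [glrReal_eq hcpos hP.1 hQ.1, lt_sub_iff_add_lt, ← mul_lt_mul_iff_right₀ hn'] at hglr
  have heq : n * (klReal (empType x) (mix ((N : ℝ) / n) (empType x) (empType t)) +
      (N : ℝ) / n * klReal (empType t) (mix ((N : ℝ) / n) (empType x) (empType t)) +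
        polyLog α n N / n) =
      n * klReal (empType x) (mix ((N : ℝ) / n) (empType x) (empType t)) +
      N * klReal (empType t) (mix ((N : ℝ) / n) (empType x) (empType t)) + polyLog α n N := by
    generalize klReal (empType x) (mix ((N : ℝ) / n) (empType x) (empType t)) = u
    generalize klReal (empType t) (mix ((N : ℝ) / n) (empType x) (empType t)) = v
    field_simp
  rw [heq] at hglr
  linarith

include hc in
/-- The acceptance region of the equilibrium for `λ` is a strategy of the defender for `λ/2`, the
difference absorbing the number of types. -/
lemma eventually_eqRegionTr_mem {lam : ℝ} (hlam : 0 < lam) :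
    ∀ᶠ n : ℕ in atTop, eqRegionTr α n ⌊c * n⌋₊ lam ∈ defenderTr α n ⌊c * n⌋₊ (lam / 2) := by
  filter_upwards [eventually_ne_atTop 0, (tendsto_floor_mul_atTop hc).eventually_ne_atTop 0,
    (tendsto_polyLog_div α hc).eventually_le_const (show 0 < lam / 4 by positivity)]
    with n hn hN hpoly
  generalize ⌊c * n⌋₊ = N at *
  have hn' : (0 : ℝ) < n := by exact_mod_cast Nat.pos_of_ne_zero hn
  have hcpos : (0 : ℝ) < (N : ℝ) / n := div_pos (by exact_mod_cast Nat.pos_of_ne_zero hN) hn'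
  rw [div_le_iff₀ hn'] at hpoly
  refine ⟨fun PQ h => ⟨h.1, h.2.1⟩, fun P hP => ?_⟩
  have hup := sum_sum_seqProb_le hn hN hP.1 hP.1
    (fun x t => (empType x, empType t) ∉ eqRegionTr α n N lam)
    (B := n * lam - polyLog α n N) ?_
  · rw [falsePosTr_eq _ fun _ _ => Iff.rfl]
    refine hup.trans ?_
    rw [Real.rpow_le_rpow_left_iff one_lt_two]
    linarith
  · intro x t hnot hx ht
    rw [mem_eqRegionTr_iff hn hN (empType_mem_typesOf x) (empType_mem_typesOf t), not_lt] at hnot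
    have h1 := glrReal_le hcpos (empType_mem_stdSimplex hn x) (empType_mem_stdSimplex hN t) hP
      hx ht
    have h2 := mul_le_mul_of_nonneg_left (hnot.trans h1) hn'.le
    have h3 : n * (lam - polyLog α n N / n) = n * lam - polyLog α n N := by field_simp
    have h4 : n * (klReal (empType x) P + (N : ℝ) / n * klReal (empType t) P) =
        n * klReal (empType x) P + N * klReal (empType t) P := by field_simp
    rwa [h3, h4] at h2

lemma typesOf_mem_defenderTr (n N : ℕ) (lam : ℝ) :
    typesOf α n ×ˢ typesOf α N ∈ defenderTr α n N lam := by
  refine ⟨subset_rfl, fun P _ => ?_⟩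
  have : falsePosTr n N P (typesOf α n ×ˢ typesOf α N) = 0 :=
    Finset.sum_eq_zero fun x _ => Finset.sum_eq_zero fun t _ =>
      if_pos ⟨⟨x, rfl⟩, ⟨t, rfl⟩⟩
  rw [this]
  positivity

include hPX hPY hc in
lemma eqExp_mem_achievableTr {lam : ℝ} (hlam : 0 < lam) :
    eqExp c d L PX PY lam ∈ achievableTr c d L PX PY := by
  classical
  refine ⟨lam / 2, by positivity, fun n =>
    if eqRegionTr α n ⌊c * n⌋₊ lam ∈ defenderTr α n ⌊c * n⌋₊ (lam / 2) then
      eqRegionTr α n ⌊c * n⌋₊ lam else typesOf α n ×ˢ typesOf α ⌊c * n⌋₊, fun n => ?_,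
    fun S hS => ?_⟩
  · dsimp only
    split_ifs with h
    exacts [h, typesOf_mem_defenderTr _ _ _]
  · refine (eqExp_le_liminf hPX hPY hc lam S hS).trans (le_of_eq (liminf_congr ?_))
    filter_upwards [eventually_eqRegionTr_mem (α := α) hc hlam] with n hn
    rw [if_pos hn]

include hd hself hPX hPY hc hL in
lemma isLUB_achievableTr :
    IsLUB (achievableTr c d L PX PY) (minObjTr c PX PY (gammaZero d L)) := by
  constructor
  · rintro e ⟨lam, hlam, Λ, hΛ, he⟩
    choose S hS using fun n : ℕ => exists_isEqAttackTr (α := α) hself hL n ⌊c * n⌋₊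
    refine (he S fun n => (hS n).1).trans (le_trans ?_ (eqExp_le hd hself hPX hc hL hlam))
    have hlim := (isFalseNegExpTr_eqExp hself hPX hPY hc hL lam).2 S hS
    rw [← hlim.liminf_eq]
    refine liminf_le_liminf ?_
    filter_upwards [eventually_ne_atTop 0, (tendsto_floor_mul_atTop hc).eventually_ne_atTop 0]
      with n hn hN
    exact expRate_antitone n (falseNegTr_nonneg hPX.1 hPY.1 _ _)
      (falseNegTr_mono hPX.1 hPY.1 (eqRegionTr_subset hn hN (hΛ n)) _)
  · intro u hu
    refine le_of_tendsto (tendsto_eqExp hd hself hPX hc hL) ?_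
    filter_upwards [self_mem_nhdsWithin] with lam hlam
    exact hu (eqExp_mem_achievableTr hPX hPY hc hlam)

include hd hself hPX hPY hc hL in
lemma distinguishableTr_iff : DistinguishableTr c d L PX PY ↔ L < EMD d PY PX := by
  have hlub := isLUB_achievableTr hd hself hPX hPY hc hL
  have h0 := minObjTr_nonneg hd hself hPX hPY hc hL
  have hiff := minObjTr_eq_zero_iff hd hself hPX hPY hc hL
  have h1 : DistinguishableTr c d L PX PY ↔ 0 < minObjTr c PX PY (gammaZero d L) :=
    (lt_isLUB_iff hlub).symm
  rw [h1, h0.lt_iff_ne, ne_comm, Ne, hiff, gammaZero, Set.mem_ofPred_eq, not_and, not_le]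
  exact ⟨fun h => h hPY, fun h _ => h⟩

/-! ### The game with known sources -/

lemma typesOf_mem_defenderKs (PX : α → ℝ) (n : ℕ) (lam : ℝ) :
    typesOf α n ∈ defenderKs PX n lam := by
  refine ⟨subset_rfl, ?_⟩
  have : falsePosKs n PX (typesOf α n) = 0 :=
    Finset.sum_eq_zero fun x _ => if_pos ⟨x, rfl⟩
  rw [this]
  positivity

lemma falseNegKs_nonneg {PY : α → ℝ} (hPY : ∀ a, 0 ≤ PY a) {n : ℕ} (Λ : Set (α → ℝ))
    (S : (Fin n → α) → (α → α → ℝ)) : 0 ≤ falseNegKs PY Λ S := by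
  refine Finset.sum_nonneg fun y _ => ?_
  split_ifs
  exacts [seqProb_nonneg hPY y, le_rfl]

/-- The types whose divergence from `PX` is less than `lam`. -/
def klRegion (PX : α → ℝ) (n : ℕ) (lam : ℝ) : Set (α → ℝ) :=
  {P | P ∈ typesOf α n ∧ klBits P PX < (lam : EReal)}

lemma eventually_klRegion_mem {PX : α → ℝ} (hPX : ∀ a, 0 ≤ PX a) {lam : ℝ} (hlam : 0 < lam) :
    ∀ᶠ n : ℕ in atTop, klRegion PX n lam ∈ defenderKs PX n (lam / 2) := by
  filter_upwards [eventually_ne_atTop 0,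
    (tendsto_polyLog_zero_div α).eventually_le_const (show (0 : ℝ) < lam / 2 by positivity)]
    with n hn hpoly
  have hn' : (0 : ℝ) < n := by exact_mod_cast Nat.pos_of_ne_zero hn
  rw [div_le_iff₀ hn'] at hpoly
  refine ⟨fun P h => h.1, ?_⟩
  have hup := sum_seqProb_le hn hPX (fun x => empType x ∉ klRegion PX n lam) (B := n * lam) ?_
  · rw [falsePosKs_eq _ fun _ => Iff.rfl]
    refine hup.trans ?_
    rw [Real.rpow_le_rpow_left_iff one_lt_two]
    linarith
  · intro x hnot hx
    refine mul_le_mul_of_nonneg_left ?_ hn'.le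
    by_contra hlt
    refine hnot ⟨⟨x, rfl⟩, ?_⟩
    rw [klBits_of_absCont hx]
    exact_mod_cast not_le.1 hlt

include hd hself hPX hPY hL in
lemma distinguishableKs_of_lt (hlt : L < EMD d PY PX) : DistinguishableKs d L PX PY := by
  classical
  -- The minimum `m` of `D(S_Z‖PX) + D(P‖PY)` over the maps with distortion at most `L` is
  -- positive, so a type that is accepted within `m/2` of `PX` comes from one beyond `m/2` of `PY`.
  have hpos : 0 < minObjTr 1 PX PY (gammaZero d L) := by
    refine (minObjTr_nonneg hd hself hPX hPY one_pos hL).lt_of_ne' fun h0 => ?_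
    exact absurd ((minObjTr_eq_zero_iff hd hself hPX hPY one_pos hL).1 h0).2 (not_le.2 hlt)
  obtain ⟨m, hm0, hm⟩ := EReal.lt_iff_exists_real_btwn.1 hpos
  have hm0' : 0 < m := by exact_mod_cast hm0
  refine ⟨((m / 2 : ℝ) : EReal), ⟨m / 2 / 2, by positivity, fun n =>
    if klRegion PX n (m / 2) ∈ defenderKs PX n (m / 2 / 2) then klRegion PX n (m / 2)
      else typesOf α n, fun n => ?_, fun S hS => ?_⟩, ?_⟩
  · dsimp only
    split_ifs with h
    exacts [h, typesOf_mem_defenderKs _ _ _]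
  · refine le_liminf_of_forall_real (tendsto_polyLog_zero_div α) fun b hb => ?_
    have hb' : b < m / 2 := by exact_mod_cast hb
    filter_upwards [eventually_ne_atTop 0,
      eventually_klRegion_mem hPX.1 (show 0 < m / 2 by positivity)] with n hn hmem
    rw [if_pos hmem]
    refine le_expRate hn (falseNegKs_nonneg hPY.1 _ _) ?_
    refine sum_seqProb_le hn hPY.1 (fun y => outMarg (S n y) ∈ klRegion PX n (m / 2)) ?_
    intro y hA hy
    refine mul_le_mul_of_nonneg_left ?_ n.cast_nonneg
    have hbd := mem_boundedMaps_of_admissible hn (hS n y)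
    have hin : inMarg (S n y) = empType y := (hS n y).2.1
    have h1 := hm.trans_le (minObjTr_le_pairExp (PX := PX) (PY := PY) (c := 1) hd hbd)
    have hx := absCont_of_klBits_ne_top (hA.2.trans (EReal.coe_lt_top _)).ne
    rw [pairExp_of_absCont hx (hin ▸ hy), hin] at h1
    have h2 : m < 1 * klReal (outMarg (S n y)) PX + klReal (empType y) PY := by exact_mod_cast h1
    have h3 := hA.2
    rw [klBits_of_absCont hx] at h3
    have h4 : klReal (outMarg (S n y)) PX < m / 2 := by exact_mod_cast h3
    linarith
  · exact_mod_cast half_pos hm0'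

/-- Every strategy of the defender accepts the types that are close to `PX` in divergence. -/
lemma mem_of_mem_defenderKs {n : ℕ} (hn : n ≠ 0) {PX : α → ℝ} (hPX : ∀ a, 0 ≤ PX a) {lam : ℝ}
    {Λ : Set (α → ℝ)} (hΛ : Λ ∈ defenderKs PX n lam) {P : α → ℝ} (hP : P ∈ typesOf α n)
    (hac : AbsCont P PX) (hlt : klReal P PX + polyLog α n 0 / n < lam) : P ∈ Λ := by
  by_contra hnot
  obtain ⟨x, rfl⟩ := hP
  have hn' : (0 : ℝ) < n := by exact_mod_cast Nat.pos_of_ne_zero hn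
  have hlow := le_sum_seqProb hn hPX (fun x => empType x ∉ Λ) x hac
    (fun x' hx' => by rwa [hx'])
  have hup := hΛ.2
  rw [falsePosKs_eq _ fun _ => Iff.rfl] at hup
  have h := hlow.trans hup
  rw [Real.rpow_le_rpow_left_iff one_lt_two] at h
  rw [← mul_lt_mul_iff_right₀ hn', mul_add, mul_div_cancel₀ _ hn'.ne'] at hlt
  linarith

include hself hPX hPY hL in
lemma not_distinguishableKs_of_le (hle : EMD d PY PX ≤ L) : ¬ DistinguishableKs d L PX PY := by
  classical
  rintro ⟨e, ⟨lam, hlam, Λ, hΛ, he⟩, hpos⟩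
  obtain ⟨T, hT, hTin, hTout⟩ := exists_mem_boundedMaps hPY hPX hle
  obtain ⟨T', y₀, hadm, hac1, hac2, hout, hin⟩ := exists_tendsto_admissible hT
  rw [hTout] at hac1 hout
  rw [hTin] at hac2 hin
  choose I hI using fun (n : ℕ) (y : Fin n → α) =>
    nonempty_admissibleMaps (d := d) hself hL y
  -- The attack moves the types `empType (y₀ n)`, which tend to `PY`, to types that tend to `PX`.
  set S : (n : ℕ) → (Fin n → α) → (α → α → ℝ) := fun n y =>
    if n ≠ 0 ∧ empType y = empType (y₀ n) then T' n else I n y with hSdef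
  have hS : ∀ n, S n ∈ attackerKs d L n := by
    intro n y
    rw [hSdef]
    dsimp only
    split_ifs with h
    · rw [h.2]; exact hadm n h.1
    · exact hI n y
  have hexp : Tendsto (fun n : ℕ => klReal (empType (y₀ n)) PY + polyLog α n 0 / n) atTop
      (𝓝 (klReal PY PY + 0)) :=
    (((continuous_klReal PY).tendsto _).comp hin).add (tendsto_polyLog_zero_div α)
  have hkl : Tendsto (fun n : ℕ => klReal (outMarg (T' n)) PX + polyLog α n 0 / n) atTop
      (𝓝 (klReal PX PX + 0)) :=
    (((continuous_klReal PX).tendsto _).comp hout).add (tendsto_polyLog_zero_div α)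
  rw [klReal_self, add_zero] at hexp hkl
  have hexp' := (continuous_coe_real_ereal.tendsto _).comp hexp
  refine absurd ((he S hS).trans ?_) (not_le.2 hpos)
  rw [← EReal.coe_zero, ← hexp'.liminf_eq]
  refine liminf_le_liminf ?_
  filter_upwards [eventually_ne_atTop 0, hkl.eventually_lt_const hlam] with n hn hlt
  have hlow := le_sum_seqProb hn hPY.1 (fun y => outMarg (S n y) ∈ Λ n) (y₀ n) (hac2 n) ?_
  · refine (expRate_le hn hlow).trans (le_of_eq ?_)
    rw [neg_div, sub_neg_eq_add]
    rfl
  · intro y hy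
    have hSy : S n y = T' n := if_pos ⟨hn, hy⟩
    rw [hSy]
    exact mem_of_mem_defenderKs hn hPX.1 (hΛ n) (outMarg_mem_typesOf (hadm n hn)) (hac1 n) hlt

include hd hself hPX hPY hL in
lemma distinguishableKs_iff : DistinguishableKs d L PX PY ↔ L < EMD d PY PX :=
  ⟨fun h => not_le.1 fun hle => not_distinguishableKs_of_le hself hPX hPY hL hle h,
    distinguishableKs_of_lt hd hself hPX hPY hL⟩

lemma sSup_nonneg_lt {a : ℝ} (ha : 0 ≤ a) : sSup {x : ℝ | 0 ≤ x ∧ x < a} = a := by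
  rcases ha.eq_or_lt with rfl | h
  · have : {x : ℝ | 0 ≤ x ∧ x < 0} = ∅ := by
      ext x; simp
    rw [this, Real.sSup_empty]
  · exact csSup_Ico h

include hd hself hPX hPY hc in
lemma securityMarginTr_eq : securityMarginTr c d PX PY = EMD d PY PX := by
  have : {L : ℝ | 0 ≤ L ∧ DistinguishableTr c d L PX PY} = {L | 0 ≤ L ∧ L < EMD d PY PX} :=
    Set.ext fun L => and_congr_right fun hL => distinguishableTr_iff hd hself hPX hPY hc hL
  rw [securityMarginTr, this, sSup_nonneg_lt (EMD_nonneg hd _ _)]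

include hd hself hPX hPY in
lemma securityMarginKs_eq : securityMarginKs d PX PY = EMD d PY PX := by
  have : {L : ℝ | 0 ≤ L ∧ DistinguishableKs d L PX PY} = {L | 0 ≤ L ∧ L < EMD d PY PX} :=
    Set.ext fun L => and_congr_right fun hL => distinguishableKs_iff hd hself hPX hPY hL
  rw [securityMarginKs, this, sSup_nonneg_lt (EMD_nonneg hd _ _)]

end Game

end SourceID

theorem theorem6 {α : Type*} [Fintype α] (d : α → α → ℝ)
    (hd_nonneg : ∀ i j, 0 ≤ d i j) (hd_self : ∀ i, d i i = 0)
    (PX PY : α → ℝ) (hPX : PX ∈ stdSimplex ℝ α) (hPY : PY ∈ stdSimplex ℝ α)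
    (c : ℝ) (hc : 0 < c) (L : ℝ) (hL : 0 ≤ L) :
    -- the minima in the limit formula are attained
    (∀ R ∈ stdSimplex ℝ α,
      IsLeast ((fun P => klBits P PY) '' gammaZero d L R) (minKl PY (gammaZero d L R))) ∧
    IsLeast (objTr c PX PY (gammaZero d L) '' stdSimplex ℝ α)
      (minObjTr c PX PY (gammaZero d L)) ∧
    -- the false negative exponent at the equilibrium exists and converges as `λ → 0`
    (∃ ε : ℝ → EReal, (∀ lam : ℝ, 0 < lam → IsFalseNegExpTr c d L PX PY lam (ε lam)) ∧
      Tendsto ε (𝓝[>] 0) (𝓝 (minObjTr c PX PY (gammaZero d L)))) ∧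
    -- so does its single-letter expression
    Tendsto (fun lam : ℝ => minObjTr c PX PY (gammaTr c d L lam)) (𝓝[>] 0)
      (𝓝 (minObjTr c PX PY (gammaZero d L))) ∧
    -- the limit is the best exponent that the defender can achieve
    IsLUB (achievableTr c d L PX PY) (minObjTr c PX PY (gammaZero d L)) ∧
    -- when the limit vanishes
    (minObjTr c PX PY (gammaZero d L) = 0 ↔ PY ∈ gammaZero d L PX) ∧
    -- security margins
    (∀ L' : ℝ, 0 ≤ L' → (DistinguishableTr c d L' PX PY ↔ L' < EMD d PY PX)) ∧
    (∀ L' : ℝ, 0 ≤ L' → (DistinguishableKs d L' PX PY ↔ L' < EMD d PY PX)) ∧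
    securityMarginTr c d PX PY = securityMarginKs d PX PY ∧
    securityMarginTr c d PX PY = EMD d PY PX ∧
    ((∀ i j, d i j = d j i) → securityMarginTr c d PX PY = EMD d PX PY) := by
  refine ⟨fun R hR => SourceID.isLeast_minKl_gammaZero hd_nonneg hd_self hL PY hR,
    (SourceID.exists_isLeast_minObjTr hd_nonneg hd_self hPX hc hL).2,
    ⟨SourceID.eqExp c d L PX PY,
      fun lam _ => SourceID.isFalseNegExpTr_eqExp hd_self hPX hPY hc hL lam,
      SourceID.tendsto_eqExp hd_nonneg hd_self hPX hc hL⟩,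
    SourceID.tendsto_minObjTr_gammaTr hd_nonneg hPY hc,
    SourceID.isLUB_achievableTr hd_nonneg hd_self hPX hPY hc hL,
    SourceID.minObjTr_eq_zero_iff hd_nonneg hd_self hPX hPY hc hL,
    fun L' hL' => SourceID.distinguishableTr_iff hd_nonneg hd_self hPX hPY hc hL',
    fun L' hL' => SourceID.distinguishableKs_iff hd_nonneg hd_self hPX hPY hL', ?_,
    SourceID.securityMarginTr_eq hd_nonneg hd_self hPX hPY hc, fun hsymm => ?_⟩
  · rw [SourceID.securityMarginTr_eq hd_nonneg hd_self hPX hPY hc,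
      SourceID.securityMarginKs_eq hd_nonneg hd_self hPX hPY]
  · rw [SourceID.securityMarginTr_eq hd_nonneg hd_self hPX hPY hc, SourceID.EMD_comm hsymm]
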